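/- Let $D \subset \mathbb C$ be a bounded simply-connected domain (open, connected, non-empty), let $K(z,t)$ be its Bergman kernel (for $t\in D$, $K(\cdot,t)$ is the holomorphic function in $L^2(D)$, with respect to area measure, such that $f(t)=\int_D f\,\overline{K(\cdot,t)}\,dA$ for every holomorphic $f\in L^2(D)$), and let $g(z)=\frac{\partial^2}{\partial z\,\partial\bar z}\log K(z,z)$ be its Bergman metric. For $p\in D$, the Bergman representative coordinate relative to $p$ is $$T(z)=g(p)^{-1}\left(K(z,p)^{-1}\left.\frac{\partial}{\partial\bar t}\right|_{t=p}K(z,t)-\left.\frac{\partial}{\partial\bar t}\right|_{t=p}\log K(t,t)\right).$$ We say that $D$ satisfies local $C^1$-connectivity around $q\in\partial D$ if for every $\epsilon>0$ there is an open set $U_\epsilon\ni q$ such that any $x,y\in U_\epsilon\cap D$ can be joined by a piecewise $C^1$ path in $D$ of length less than $\epsilon$. Then for every $p\in D$ we have $g(p)>0$ and $K(z,p)\neq 0$ for all $z\in D$, and $T$ is a biholomorphic map of $D$ onto the disc $\mathbb D_r=\{w\in\mathbb C: |w|^2<2/g(p)\}$. Moreover: 1. If $D$ satisfies local $C^1$-connectivity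 around every $q\in\partial D$ and there are a point $p_0\in D$ (for instance $p_0=p$) and a constant $C_1>0$ with $|K(z,p_0)|\le C_1$ for all $z\in D$, then $T$ extends continuously to $\overline D$. 2. If there is a constant $C_2>0$ with $|K(z,p)|\ge C_2$ for all $z\in D$, then the inverse map $T^{-1}:\mathbb D_r\to D$ extends continuously to $\overline{\mathbb D_r}$, and $\partial D$ is locally connected. 3. If the hypotheses of both 1 and 2 hold, then $T$ extends to a homeomorphism $\overline D\to\overline{\mathbb D_r}$, and $\partial D$ is a Jordan curve. -/

import Mathlib

open MeasureTheory Set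

noncomputable section

/-- The Bergman space `A²(D)`: holomorphic functions on `D` that are square integrable on `D`
with respect to Lebesgue (area) measure.  Only the values on `D` matter. -/
def bergmanSpace (D : Set ℂ) : Set (ℂ → ℂ) :=
  {f | DifferentiableOn ℂ f D ∧ MemLp f 2 (volume.restrict D)}

/-- `k` represents evaluation at `w` on the Bergman space of `D`:
`k ∈ A²(D)` and `f w = ∫_D f(z) conj(k(z)) dA(z)` for all `f ∈ A²(D)`. -/
def IsBergmanReproducing (D : Set ℂ) (w : ℂ) (k : ℂ → ℂ) : Prop :=
  k ∈ bergmanSpace D ∧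
    ∀ f ∈ bergmanSpace D, f w = ∫ z in D, f z * (starRingEnd ℂ) (k z)

open Classical in
/-- The Bergman kernel `K(z, w)` of `D`: for `w ∈ D`, `K(·, w)` is the element of `A²(D)` that
represents evaluation at `w`.  For an open set `D` and `z, w ∈ D` the representing function exists
(Riesz representation) and its value at `z` is unique.  The default value `0` serves only
to make the function total. -/
def bergmanKernel (D : Set ℂ) (z w : ℂ) : ℂ :=
  if h : ∃ k, IsBergmanReproducing D w k then h.choose z else 0

/-- The Wirtinger derivative `∂F/∂z = (F_x - i F_y) / 2`. -/
def wirtingerDz (F : ℂ → ℂ) (p : ℂ) : ℂ :=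
  (fderiv ℝ F p 1 - Complex.I * fderiv ℝ F p Complex.I) / 2

/-- The Wirtinger derivative `∂F/∂z̄ = (F_x + i F_y) / 2`. -/
def wirtingerDzbar (F : ℂ → ℂ) (p : ℂ) : ℂ :=
  (fderiv ℝ F p 1 + Complex.I * fderiv ℝ F p Complex.I) / 2

/-- The function `t ↦ log K(t, t)`.  Here `K(t, t) = ∫_D |K(·, t)|²` is a nonnegative real
number, positive on a bounded domain. -/
def logBergmanDiag (D : Set ℂ) (t : ℂ) : ℂ := Complex.log (bergmanKernel D t t)

/-- The coefficient `g(p) = ∂²/∂z∂z̄ log K(z, z)` at `z = p` of the Bergman metric of `D`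
(a real number, because `log K(z, z)` is real valued). -/
def bergmanMetric (D : Set ℂ) (p : ℂ) : ℝ :=
  (wirtingerDz (fun z => wirtingerDzbar (logBergmanDiag D) z) p).re

/-- The Bergman representative coordinate of `D` relative to `p`:
`T(z) = g(p)⁻¹ (K(z, p)⁻¹ ∂/∂t̄|_{t = p} K(z, t) - ∂/∂t̄|_{t = p} log K(t, t))`. -/
def bergmanCoord (D : Set ℂ) (p z : ℂ) : ℂ :=
  ((bergmanMetric D p : ℂ))⁻¹ *
    ((bergmanKernel D z p)⁻¹ * wirtingerDzbar (fun t => bergmanKernel D z t) p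
      - wirtingerDzbar (logBergmanDiag D) p)

/-- The disc `{w : |w|² < 2 / g(p)}`. -/
def bergmanDisc (D : Set ℂ) (p : ℂ) : Set ℂ := {w | ‖w‖ ^ 2 < 2 / bergmanMetric D p}

/-- `f` is a biholomorphic map of `U` onto `V` with inverse `S`. -/
def IsBiholomorphicWithInv (f S : ℂ → ℂ) (U V : Set ℂ) : Prop :=
  DifferentiableOn ℂ f U ∧ DifferentiableOn ℂ S V ∧ MapsTo f U V ∧ MapsTo S V U ∧
    InvOn S f U V

/-- `f` is a biholomorphic map of `U` onto `V`. -/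
def IsBiholomorphicOnto (f : ℂ → ℂ) (U V : Set ℂ) : Prop :=
  ∃ S : ℂ → ℂ, IsBiholomorphicWithInv f S U V

/-- `γ : [0, 1] → ℂ` is a piecewise `C¹` path: it is continuous, and `C¹` (with one-sided
derivatives at the end points) on each piece of a finite partition of `[0, 1]`. -/
def IsPiecewiseC1Path (γ : ℝ → ℂ) : Prop :=
  ContinuousOn γ (Icc 0 1) ∧
    ∃ (n : ℕ) (t : ℕ → ℝ), t 0 = 0 ∧ t n = 1 ∧
      ∀ i < n, t i < t (i + 1) ∧ ContDiffOn ℝ 1 γ (Icc (t i) (t (i + 1)))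

/-- Local `C¹`-connectivity of `D` around `q`: for every `ε > 0` there is an open `U ∋ q`
such that any `x, y ∈ U ∩ D` are joined by a piecewise `C¹` path in `D` of length less than `ε`. -/
def LocallyC1ConnectedAround (D : Set ℂ) (q : ℂ) : Prop :=
  ∀ ε : ℝ, 0 < ε → ∃ U : Set ℂ, IsOpen U ∧ q ∈ U ∧
    ∀ x ∈ U ∩ D, ∀ y ∈ U ∩ D, ∃ γ : ℝ → ℂ, IsPiecewiseC1Path γ ∧ MapsTo γ (Icc 0 1) D ∧
      γ 0 = x ∧ γ 1 = y ∧ eVariationOn γ (Icc 0 1) < ENNReal.ofReal ε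

/-- A Jordan curve: the image of the circle under an injective continuous map. -/
def IsJordanCurve (J : Set ℂ) : Prop :=
  ∃ γ : Circle → ℂ, Continuous γ ∧ Function.Injective γ ∧ range γ = J

/-- Hypothesis of the first part: `D` is locally `C¹`-connected around each boundary point, and
`|K(·, p₀)|` is bounded above on `D` for some `p₀ ∈ D`. -/
def BergmanUpperCondition (D : Set ℂ) : Prop :=
  (∀ q ∈ frontier D, LocallyC1ConnectedAround D q) ∧
    ∃ p₀ ∈ D, ∃ C : ℝ, 0 < C ∧ ∀ z ∈ D, ‖bergmanKernel D z p₀‖ ≤ C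

/-- Hypothesis of the second part: `|K(·, p)|` is bounded below on `D` by a positive constant. -/
def BergmanLowerCondition (D : Set ℂ) (p : ℂ) : Prop :=
  ∃ C : ℝ, 0 < C ∧ ∀ z ∈ D, C ≤ ‖bergmanKernel D z p‖

end

/-! Everything reduces to the Riemann map `f` of `D` onto the unit disc with `f p = 0`. The area
mean value property, transported by `f` and by disc automorphisms, gives K(z,w) = f'(z) conj(f'(w))
/ (π (1 - conj(f(w)) f(z))²). Hence K(z,p) = f'(z) conj(f'(p)) / π has no zero, g(p) = 2|f'(p)|², T
= f / f'(p), and the target disc has radius 1/|f'(p)| (`bergmanKernel_eq_of_isDiscEmbedding`,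
`bergmanMetric_eq_of_isDiscEmbedding`, `bergmanCoord_eq_of_isDiscEmbedding`).

Bounds on |K(·,p)| are therefore bounds on |f'|. An upper bound makes `f` stretch path lengths by at
most a constant factor, so short paths near a boundary point force the Cauchy criterion there. A
lower bound makes the inverse Lipschitz, because the disc is convex, so the inverse extends to the
closed disc and maps the circle onto ∂D; local connectivity follows, since ∂D is a quotient of the
circle. With both bounds, the two extensions are mutually inverse by density. -/

/-! ### Normal families and Hurwitz's theorem. -/

open Filter Topology Metric ComplexConjugate in
/-- Pointwise limits along an ultrafilter of holomorphic functions bounded by one are locally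
uniform limits. -/
theorem exists_tendstoLocallyUniformlyOn_of_norm_le_one {U : Set ℂ} (hU : IsOpen U) {ι : Type*}
    {F : ι → ℂ → ℂ} (hd : ∀ n, DifferentiableOn ℂ (F n) U) (hb : ∀ n, ∀ z ∈ U, ‖F n z‖ ≤ 1)
    (l : Ultrafilter ι) :
    ∃ f : ℂ → ℂ, TendstoLocallyUniformlyOn F f l U ∧ ∀ z ∈ U, ‖f z‖ ≤ 1 := by
  have key : ∀ z, ∃ w, z ∈ U → Tendsto (fun n => F n z) l (𝓝 w) ∧ ‖w‖ ≤ 1 := by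
    intro z
    by_cases hz : z ∈ U
    · obtain ⟨w, hw, hlim⟩ := (isCompact_closedBall (0 : ℂ) 1).ultrafilter_le_nhds
        (l.map fun n => F n z) (by
          rw [le_principal_iff]
          refine mem_map.2 (Eventually.of_forall fun n => ?_)
          simpa using hb n z hz)
      exact ⟨w, fun _ => ⟨hlim, by simpa using hw⟩⟩
    · exact ⟨0, fun h => absurd h hz⟩
  choose f hf using key
  refine ⟨f, ?_, fun z hz => (hf z hz).2⟩
  rw [Metric.tendstoLocallyUniformlyOn_iff]
  intro ε hε z hz
  obtain ⟨r, hr, hrU⟩ := Metric.isOpen_iff.1 hU z hz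
  -- By the Schwarz lemma the family is equi-Lipschitz near `z`; this upgrades pointwise convergence
  -- to locally uniform convergence.
  have lip : ∀ n, ∀ x ∈ ball z r, dist (F n x) (F n z) ≤ 2 / r * dist x z := by
    intro n x hx
    refine Complex.dist_le_div_mul_dist_of_mapsTo_ball ((hd n).mono hrU) ?_ hx
    intro y hy
    rw [mem_closedBall, dist_eq_norm]
    have h1 := hb n y (hrU hy)
    have h2 := hb n z hz
    linarith [norm_sub_le (F n y) (F n z)]
  have lip' : ∀ x ∈ ball z r, dist (f x) (f z) ≤ 2 / r * dist x z := by
    intro x hx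
    exact le_of_tendsto ((hf x (hrU hx)).1.dist (hf z hz).1) (Eventually.of_forall
      fun n => lip n x hx)
  set δ := min r (r * ε / 8) with hδ
  have hδ0 : 0 < δ := by positivity
  have hsub : ball z δ ⊆ ball z r := ball_subset_ball (min_le_left _ _)
  refine ⟨ball z δ, mem_nhdsWithin_of_mem_nhds (ball_mem_nhds z hδ0), ?_⟩
  have h3 : ∀ᶠ n in (l : Filter ι), dist (F n z) (f z) < ε / 4 :=
    (hf z hz).1.eventually (ball_mem_nhds _ (by positivity))
  filter_upwards [h3] with n hn x hx
  have hxd : dist x z < r * ε / 8 := lt_of_lt_of_le hx (min_le_right _ _)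
  have h4 : 2 / r * dist x z ≤ ε / 4 := by
    calc 2 / r * dist x z ≤ 2 / r * (r * ε / 8) := by gcongr
      _ = ε / 4 := by field_simp; ring
  have h5 := (lip n x (hsub hx)).trans h4
  have h6 := (lip' x (hsub hx)).trans h4
  have h7 := dist_triangle4 (f x) (f z) (F n z) (F n x)
  rw [dist_comm (f z) (F n z), dist_comm (F n z) (F n x)] at h7
  linarith

open Filter Topology Metric in
/-- Hurwitz: a zero of a locally uniform limit of nonvanishing holomorphic functions is not
isolated. -/
theorem eventually_eq_zero_of_tendstoLocallyUniformlyOn {U : Set ℂ} (hU : IsOpen U) {ι : Type*}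
    {F : ι → ℂ → ℂ} {f : ℂ → ℂ} {l : Filter ι} [l.NeBot] (hlim : TendstoLocallyUniformlyOn F f l U)
    (hd : ∀ n, DifferentiableOn ℂ (F n) U) (h0 : ∀ n, ∀ z ∈ U, F n z ≠ 0) {b : ℂ} (hb : b ∈ U)
    (hfb : f b = 0) : ∀ᶠ z in 𝓝 b, f z = 0 := by
  have hfd : DifferentiableOn ℂ f U := hlim.differentiableOn (Eventually.of_forall hd) hU
  have hfa : AnalyticAt ℂ f b := hfd.analyticAt (hU.mem_nhds hb)
  refine hfa.eventually_eq_zero_or_eventually_ne_zero.resolve_right fun hne => ?_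
  rw [eventually_nhdsWithin_iff] at hne
  obtain ⟨R, hR, hRs⟩ := Metric.mem_nhds_iff.1 (hne.and (hU.mem_nhds hb))
  set r := R / 2 with hr
  have hr0 : 0 < r := by positivity
  have hcb : closedBall b r ⊆ ball b R := closedBall_subset_ball (by linarith)
  have hcU : closedBall b r ⊆ U := fun z hz => (hRs (hcb hz)).2
  have hsph : ∀ z ∈ sphere b r, f z ≠ 0 := fun z hz =>
    (hRs (hcb (sphere_subset_closedBall hz))).1 (ne_of_mem_sphere hz hr0.ne')
  obtain ⟨w, hw, hmin⟩ := (isCompact_sphere b r).exists_isMinOn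
    (NormedSpace.sphere_nonempty.2 hr0.le)
    ((hfd.continuousOn.mono (sphere_subset_closedBall.trans hcU)).norm)
  set m := ‖f w‖ with hm
  have hm0 : 0 < m := norm_pos_iff.2 (hsph w hw)
  have hunif : TendstoUniformlyOn F f l (closedBall b r) :=
    (tendstoLocallyUniformlyOn_iff_forall_isCompact hU).1 hlim _ hcU (isCompact_closedBall b r)
  obtain ⟨n, hn⟩ := (Metric.tendstoUniformlyOn_iff.1 hunif (m / 2) (by positivity)).exists
  have hbd : ∀ z ∈ frontier (ball b r), ‖(F n z)⁻¹‖ ≤ (m / 2)⁻¹ := by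
    rw [frontier_ball b hr0.ne']
    intro z hz
    rw [norm_inv]
    have h1 := hn z (sphere_subset_closedBall hz)
    have h2 : m ≤ ‖f z‖ := hmin hz
    rw [dist_eq_norm] at h1
    have h3 := norm_sub_norm_le (f z) (F n z)
    exact inv_anti₀ (by positivity) (by linarith)
  -- Maximum principle for `1 / F n`: the bound on the circle gives `‖F n b‖ ≥ m / 2`, whereas `F n
  -- b` is within less than `m / 2` of `f b = 0`.
  have hdc : DiffContOnCl ℂ (fun z => (F n z)⁻¹) (ball b r) := by
    refine DifferentiableOn.diffContOnCl ?_
    rw [closure_ball b hr0.ne']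
    exact ((hd n).mono hcU).inv fun z hz => h0 n z (hcU hz)
  have h4 := Complex.norm_le_of_forall_mem_frontier_norm_le isBounded_ball hdc hbd
    (subset_closure (mem_ball_self hr0))
  have h5 := hn b (mem_closedBall_self hr0.le)
  rw [dist_eq_norm, hfb, zero_sub, norm_neg] at h5
  rw [norm_inv] at h4
  have h6 := (inv_le_inv₀ (norm_pos_iff.2 (h0 n b hb)) (by positivity)).1 h4
  linarith

/-! ### Automorphisms of the disc. -/

open ComplexConjugate in
/-- The automorphism `z ↦ (z - a) / (1 - conj a * z)` of the unit disc. -/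
noncomputable def diskMobius (a z : ℂ) : ℂ := (z - a) / (1 - conj a * z)

open ComplexConjugate in
theorem one_sub_conj_mul_ne_zero {a z : ℂ} (ha : ‖a‖ < 1) (hz : ‖z‖ < 1) :
    1 - conj a * z ≠ 0 := by
  intro h
  have h1 : ‖conj a * z‖ = 1 := by rw [← sub_eq_zero.1 h, norm_one]
  rw [norm_mul, RCLike.norm_conj] at h1
  nlinarith [norm_nonneg a, norm_nonneg z]

-- This rests on |1 - āz|² - |z - a|² = (1 - |a|²)(1 - |z|²).
open ComplexConjugate in
theorem norm_diskMobius_lt_one {a z : ℂ} (ha : ‖a‖ < 1) (hz : ‖z‖ < 1) :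
    ‖diskMobius a z‖ < 1 := by
  have h0 := one_sub_conj_mul_ne_zero ha hz
  rw [diskMobius, norm_div, div_lt_one (norm_pos_iff.2 h0)]
  refine lt_of_pow_lt_pow_left₀ 2 (norm_nonneg _) ?_
  rw [Complex.sq_norm, Complex.sq_norm]
  have ha' : Complex.normSq a < 1 := by rw [← Complex.sq_norm]; nlinarith [norm_nonneg a]
  have hz' : Complex.normSq z < 1 := by rw [← Complex.sq_norm]; nlinarith [norm_nonneg z]
  simp only [Complex.normSq_apply, Complex.sub_re, Complex.sub_im, Complex.one_re, Complex.one_im,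
    Complex.mul_re, Complex.mul_im, Complex.conj_re, Complex.conj_im] at *
  nlinarith [mul_pos (sub_pos.2 ha') (sub_pos.2 hz')]

theorem diskMobius_self (a : ℂ) : diskMobius a a = 0 := by simp [diskMobius]

open ComplexConjugate in
theorem diskMobius_neg_diskMobius {a z : ℂ} (ha : ‖a‖ < 1) (hz : ‖z‖ < 1) :
    diskMobius (-a) (diskMobius a z) = z := by
  have h0 := one_sub_conj_mul_ne_zero ha hz
  have h1 := one_sub_conj_mul_ne_zero ha ha
  have h2 : (1 - conj a * z) + conj a * (z - a) ≠ 0 := by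
    convert h1 using 1; ring
  simp only [diskMobius, map_neg]
  have h3 : 1 - -conj a * ((z - a) / (1 - conj a * z)) =
      ((1 - conj a * z) + conj a * (z - a)) / (1 - conj a * z) := by
    field_simp; ring
  have h4 : (z - a) / (1 - conj a * z) - -a = z * ((1 - conj a * z + conj a * (z - a)) /
      (1 - conj a * z)) := by
    rw [sub_neg_eq_add, div_add' _ _ _ h0, mul_div_assoc']
    congr 1
    ring
  rw [h3, h4, mul_div_assoc, div_self (div_ne_zero h2 h0), mul_one]

open ComplexConjugate in
theorem hasDerivAt_diskMobius {a z : ℂ} (ha : ‖a‖ < 1) (hz : ‖z‖ < 1) :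
    HasDerivAt (diskMobius a) ((1 - conj a * a) / (1 - conj a * z) ^ 2) z := by
  have h0 := one_sub_conj_mul_ne_zero ha hz
  have h1 : HasDerivAt (fun z : ℂ => z - a) 1 z := (hasDerivAt_id z).sub_const a
  have h2 : HasDerivAt (fun z : ℂ => 1 - conj a * z) (-(conj a * 1)) z :=
    ((hasDerivAt_id z).const_mul (conj a)).const_sub 1
  convert! h1.div h2 h0 using 1
  ring

theorem injOn_diskMobius {a : ℂ} (ha : ‖a‖ < 1) : InjOn (diskMobius a) (Metric.ball 0 1) :=
  fun x hx y hy hxy => by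
    rw [← diskMobius_neg_diskMobius (z := x) ha (by simpa using hx), hxy,
      diskMobius_neg_diskMobius ha (by simpa using hy)]

/-! ### The Riemann mapping theorem. -/

/-- A conformal embedding of `U` into the unit disc. -/
structure IsDiscEmbedding (U : Set ℂ) (f : ℂ → ℂ) : Prop where
  diff : DifferentiableOn ℂ f U
  inj : InjOn f U
  norm_lt : ∀ z ∈ U, ‖f z‖ < 1
  deriv_ne : ∀ z ∈ U, deriv f z ≠ 0

-- Hurwitz is used twice: on `F n z - F n a` away from `a` for injectivity, and on the derivatives
-- for `deriv_ne`. The open mapping theorem makes the bound by one strict.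
open Filter Topology Metric in
theorem IsDiscEmbedding.of_tendsto {U : Set ℂ} (hU : IsOpen U) (hc : IsPreconnected U) {p : ℂ}
    (hp : p ∈ U) {F : ℕ → ℂ → ℂ} (hF : ∀ n, IsDiscEmbedding U (F n)) {f : ℂ → ℂ} {l : Filter ℕ}
    [l.NeBot] (hlim : TendstoLocallyUniformlyOn F f l U) (hb : ∀ z ∈ U, ‖f z‖ ≤ 1)
    (hfp : deriv f p ≠ 0) : IsDiscEmbedding U f := by
  have hfd : DifferentiableOn ℂ f U := hlim.differentiableOn
    (Eventually.of_forall fun n => (hF n).diff) hU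
  have hfa : AnalyticOnNhd ℂ f U := hfd.analyticOnNhd hU
  have hnc : ¬ ∃ w, ∀ z ∈ U, f z = w := by
    rintro ⟨w, hw⟩
    refine hfp ?_
    have : f =ᶠ[𝓝 p] fun _ => w := by
      filter_upwards [hU.mem_nhds hp] with z hz using hw z hz
    rw [this.deriv_eq, deriv_const]
  refine ⟨hfd, ?_, ?_, ?_⟩
  · intro a ha b hb hab
    by_contra hne
    have hV : IsOpen (U \ {a}) := hU.sdiff isClosed_singleton
    have hlimV : TendstoLocallyUniformlyOn (fun n z => F n z - F n a) (fun z => f z - f a) l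
        (U \ {a}) := by
      have h1 := hlim.mono (sdiff_subset (t := {a}))
      have h2 : Tendsto (fun n => F n a) l (𝓝 (f a)) := hlim.tendsto_at ha
      have h3 : TendstoLocallyUniformlyOn (fun n (_ : ℂ) => F n a) (fun _ => f a) l (U \ {a}) := by
        rw [Metric.tendstoLocallyUniformlyOn_iff]
        intro ε hε z hz
        refine ⟨univ, univ_mem, ?_⟩
        filter_upwards [h2 (ball_mem_nhds _ hε)] with n hn y _
        rw [dist_comm]; exact hn
      exact h1.fun_sub h3
    have hz := eventually_eq_zero_of_tendstoLocallyUniformlyOn hV hlimV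
      (fun n => ((hF n).diff.mono sdiff_subset).sub_const _)
      (fun n z hz h => hz.2 ((hF n).inj hz.1 ha (sub_eq_zero.1 h)))
      (b := b) ⟨hb, fun h => hne h.symm⟩ (sub_eq_zero.2 hab.symm)
    refine hnc ⟨f a, ?_⟩
    exact hfa.eqOn_of_preconnected_of_eventuallyEq analyticOnNhd_const hc hb
      (hz.mono fun z hz => sub_eq_zero.1 hz)
  · intro z hz
    rcases hfa.is_constant_or_isOpen hc with h | h
    · exact absurd h hnc
    · have h1 : f '' U ⊆ interior (closedBall 0 1) := by
        refine interior_maximal ?_ (h U le_rfl hU)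
        rintro _ ⟨z, hz, rfl⟩
        simpa using hb z hz
      rw [interior_closedBall _ one_ne_zero] at h1
      simpa using h1 (mem_image_of_mem f hz)
  · intro z hz h
    have hlim' := hlim.deriv (Eventually.of_forall fun n => (hF n).diff) hU
    have h1 := eventually_eq_zero_of_tendstoLocallyUniformlyOn hU hlim'
      (fun n => (hF n).diff.deriv hU) (fun n z hz => (hF n).deriv_ne z hz) hz h
    exact hfp (hfa.deriv.eqOn_of_preconnected_of_eventuallyEq analyticOnNhd_const hc hz h1 hp)

theorem IsDiscEmbedding.comp_diskMobius {U : Set ℂ} (hU : IsOpen U) {w : ℂ} (hw : ‖w‖ < 1)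
    {f : ℂ → ℂ} (hf : IsDiscEmbedding U f) : IsDiscEmbedding U (diskMobius w ∘ f) := by
  have hd : ∀ z ∈ U, HasDerivAt (diskMobius w ∘ f) _ z := fun z hz =>
    (hasDerivAt_diskMobius hw (hf.norm_lt z hz)).comp z
      ((hf.diff.differentiableAt (hU.mem_nhds hz)).hasDerivAt)
  refine ⟨fun z hz => (hd z hz).differentiableAt.differentiableWithinAt, ?_, ?_, ?_⟩
  · exact (injOn_diskMobius hw).comp hf.inj
      fun z hz => by simpa using hf.norm_lt z hz
  · exact fun z hz => norm_diskMobius_lt_one hw (hf.norm_lt z hz)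
  · intro z hz
    rw [(hd z hz).deriv]
    exact mul_ne_zero (div_ne_zero (one_sub_conj_mul_ne_zero hw hw)
      (pow_ne_zero _ (one_sub_conj_mul_ne_zero hw (hf.norm_lt z hz))))
      (hf.deriv_ne z hz)

open ComplexConjugate in
theorem IsDiscEmbedding.deriv_diskMobius_comp {U : Set ℂ} (hU : IsOpen U) {w z : ℂ} (hw : ‖w‖ < 1)
    (hz : z ∈ U) {f : ℂ → ℂ} (hf : IsDiscEmbedding U f) :
    deriv (diskMobius w ∘ f) z = (1 - conj w * w) / (1 - conj w * f z) ^ 2 * deriv f z :=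
  ((hasDerivAt_diskMobius hw (hf.norm_lt z hz)).comp z
      ((hf.diff.differentiableAt (hU.mem_nhds hz)).hasDerivAt)).deriv

open Filter Topology in
/-- A continuous square root of a function is differentiable where the function is differentiable
and nonzero. -/
theorem HasDerivAt.of_continuousAt_sq {s h : ℂ → ℂ} {h' z : ℂ} (hs : ContinuousAt s z)
    (hsq : ∀ x, s x ^ 2 = h x) (hh : HasDerivAt h h' z) (h0 : s z ≠ 0) :
    HasDerivAt s (h' / (2 * s z)) z := by
  rw [hasDerivAt_iff_tendsto_slope] at hh ⊢
  have h1 : Tendsto (fun x => s x + s z) (𝓝[≠] z) (𝓝 (2 * s z)) := by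
    rw [two_mul]
    exact (hs.tendsto.mono_left nhdsWithin_le_nhds).add_const _
  have h2 : (2 * s z) ≠ 0 := mul_ne_zero two_ne_zero h0
  -- Difference of squares: the slope of `h` is the slope of `s` times `s x + s z`.
  refine (hh.div h1 h2).congr' ?_
  filter_upwards [h1.eventually_ne h2] with x hx
  simp only [slope_def_field, ← hsq, Pi.div_apply]
  rw [div_eq_iff hx]
  ring

open ComplexConjugate in
/-- Koebe's square root trick: an embedding that omits a value of the disc does not have maximal
derivative. -/
theorem IsDiscEmbedding.exists_norm_deriv_lt {U : Set ℂ} (hU : IsOpen U) (hc : IsSimplyConnected U)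
    {p : ℂ} (hp : p ∈ U) {f : ℂ → ℂ} (hf : IsDiscEmbedding U f) (hfp : f p = 0) {w : ℂ}
    (hw : ‖w‖ < 1) (hwf : w ∉ f '' U) :
    ∃ g, IsDiscEmbedding U g ∧ g p = 0 ∧ ‖deriv f p‖ < ‖deriv g p‖ := by
  set h := diskMobius w ∘ f with hh
  have hE : IsDiscEmbedding U h := hf.comp_diskMobius hU hw
  have hne : ∀ z ∈ U, h z ≠ 0 := by
    intro z hz h0
    refine hwf ⟨z, hz, injOn_diskMobius hw (by simpa using hf.norm_lt z hz) (by simpa using hw) ?_⟩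
    rw [diskMobius_self]; exact h0
  -- Simple connectivity enters here: the nonvanishing `h` has a continuous square root.
  obtain ⟨s, hs, hsq⟩ := Complex.exists_continuousOn_pow_eq hc hU hE.diff.continuousOn
    (by rintro ⟨z, hz, h0⟩; exact hne z hz h0) two_ne_zero
  have hs0 : ∀ z ∈ U, s z ≠ 0 := fun z hz h0 => hne z hz (by rw [← hsq, h0]; simp)
  have hsd : ∀ z ∈ U, HasDerivAt s (deriv h z / (2 * s z)) z := fun z hz =>
    HasDerivAt.of_continuousAt_sq (hs.continuousAt (hU.mem_nhds hz)) hsq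
      (hE.diff.differentiableAt (hU.mem_nhds hz)).hasDerivAt (hs0 z hz)
  have hsE : IsDiscEmbedding U s := by
    refine ⟨fun z hz => (hsd z hz).differentiableAt.differentiableWithinAt, ?_, ?_, ?_⟩
    · intro x hx y hy hxy
      exact hE.inj hx hy (by rw [← hsq, ← hsq, hxy])
    · intro z hz
      have h1 := hE.norm_lt z hz
      rw [← hsq, norm_pow] at h1
      exact (pow_lt_one_iff_of_nonneg (norm_nonneg _) two_ne_zero).1 h1
    · intro z hz
      rw [(hsd z hz).deriv]
      exact div_ne_zero (hE.deriv_ne z hz) (mul_ne_zero two_ne_zero (hs0 z hz))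
  refine ⟨_, hsE.comp_diskMobius hU (hsE.norm_lt p hp), diskMobius_self _, ?_⟩
  rw [hsE.deriv_diskMobius_comp hU (hsE.norm_lt p hp) hp, (hsd p hp).deriv,
    hf.deriv_diskMobius_comp hU hw hp, hfp]
  have hw2 : ‖s p‖ ^ 2 = ‖w‖ := by
    rw [← norm_pow, hsq, hh, Function.comp, hfp, diskMobius]; simp
  set t := ‖s p‖ with ht
  have ht0 : 0 < t := norm_pos_iff.2 (hs0 p hp)
  have ht1 : t < 1 := hsE.norm_lt p hp
  have e1 : (1 : ℂ) - conj (s p) * s p = ((1 - t ^ 2 : ℝ) : ℂ) := by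
    rw [mul_comm, Complex.mul_conj, ← Complex.sq_norm]; push_cast; rfl
  have e2 : (1 : ℂ) - conj w * w = ((1 - (t ^ 2) ^ 2 : ℝ) : ℂ) := by
    rw [mul_comm, Complex.mul_conj, ← Complex.sq_norm, hw2]; push_cast; rfl
  rw [e1, e2]
  have hpos : 0 < 1 - t ^ 2 := by nlinarith
  have hpos2 : 0 < 1 - (t ^ 2) ^ 2 := by nlinarith
  have hd0 : 0 < ‖deriv f p‖ := norm_pos_iff.2 (hf.deriv_ne p hp)
  simp only [norm_mul, norm_div, norm_pow, Complex.norm_real, Real.norm_eq_abs, abs_of_pos hpos,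
    abs_of_pos hpos2, mul_zero, sub_zero, one_pow, div_one, Complex.norm_ofNat, ← ht]
  -- As `f p = 0`, one has t² = |w|; the derivative gains the factor (1 + t²)/(2t), which exceeds 1
  -- because (1 - t)² > 0.
  have e3 : (1 - t ^ 2) / (1 - t ^ 2) ^ 2 * ((1 - (t ^ 2) ^ 2) * ‖deriv f p‖ / (2 * t)) =
      ‖deriv f p‖ * ((1 + t ^ 2) / (2 * t)) := by
    field_simp
    ring
  rw [e3]
  refine lt_mul_of_one_lt_right hd0 ?_
  rw [one_lt_div (by positivity)]
  nlinarith [sq_pos_of_pos (sub_pos.2 ht1)]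

open Filter Topology Metric in
/-- The Riemann mapping theorem for bounded domains. -/
theorem exists_isDiscEmbedding_image_eq_ball {U : Set ℂ} (hU : IsOpen U)
    (hb : Bornology.IsBounded U) (hc : IsSimplyConnected U) {p : ℂ} (hp : p ∈ U) :
    ∃ f, IsDiscEmbedding U f ∧ f p = 0 ∧ f '' U = ball 0 1 := by
  obtain ⟨R, hR, hUR⟩ := hb.subset_ball_lt 0 p
  have h1 : ∀ z, HasDerivAt (fun z : ℂ => (z - p) / R) (1 / R) z := fun z =>
    ((hasDerivAt_id z).sub_const p).div_const _
  have hRC : (R : ℂ) ≠ 0 := by exact_mod_cast hR.ne'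
  have hE1 : IsDiscEmbedding U fun z => (z - p) / R := by
    refine ⟨fun z _ => (h1 z).differentiableAt.differentiableWithinAt, ?_, ?_, ?_⟩
    · intro x _ y _ hxy
      simpa [hRC, div_left_inj'] using hxy
    · intro z hz
      have := hUR hz
      rw [mem_ball, dist_eq_norm] at this
      rw [norm_div, Complex.norm_real, Real.norm_eq_abs, abs_of_pos hR, div_lt_one hR]
      exact this
    · intro z _
      rw [(h1 z).deriv]
      exact one_div_ne_zero hRC
  set S : Set ℝ := {x | ∃ f, IsDiscEmbedding U f ∧ f p = 0 ∧ ‖deriv f p‖ = x} with hS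
  have hSne : S.Nonempty := ⟨_, _, hE1, by simp, rfl⟩
  obtain ⟨r, hr, hrU⟩ := Metric.isOpen_iff.1 hU p hp
  have hSbd : BddAbove S := by
    refine ⟨1 / r, ?_⟩
    rintro _ ⟨f, hf, hfp, rfl⟩
    refine Complex.norm_deriv_le_div_of_mapsTo_ball (hf.diff.mono hrU) ?_ hr
    intro z hz
    rw [hfp, mem_closedBall_zero_iff]
    exact (hf.norm_lt z (hrU hz)).le
  obtain ⟨u, -, hulim, huS⟩ := exists_seq_tendsto_sSup hSne hSbd
  choose F hF hFp hFu using huS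
  -- An ultrafilter finer than `atTop` plays the role of a convergent subsequence of the maximizing
  -- sequence.
  obtain ⟨f, hlim, hfb⟩ := exists_tendstoLocallyUniformlyOn_of_norm_le_one hU
    (fun n => (hF n).diff) (fun n z hz => ((hF n).norm_lt z hz).le) (Ultrafilter.of atTop)
  have hsup : ‖deriv f p‖ = sSup S := by
    have h2 := ((hlim.deriv (Eventually.of_forall fun n => (hF n).diff) hU).tendsto_at hp).norm
    refine tendsto_nhds_unique h2 ((hulim.mono_left (Ultrafilter.of_le atTop)).congr ?_)
    exact fun n => (hFu n).symm
  have hpos : 0 < ‖deriv f p‖ := by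
    rw [hsup]
    exact lt_of_lt_of_le (norm_pos_iff.2 (hE1.deriv_ne p hp))
      (le_csSup hSbd ⟨_, hE1, by simp, rfl⟩)
  have hE : IsDiscEmbedding U f := IsDiscEmbedding.of_tendsto hU
    hc.isPathConnected.isConnected.isPreconnected hp hF hlim hfb (norm_pos_iff.1 hpos)
  have hfp : f p = 0 := by
    refine tendsto_nhds_unique (hlim.tendsto_at hp) ?_
    simp only [hFp]
    exact tendsto_const_nhds
  refine ⟨f, hE, hfp, Subset.antisymm ?_ ?_⟩
  · rintro _ ⟨z, hz, rfl⟩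
    simpa using hE.norm_lt z hz
  · intro w hw
    by_contra hwf
    obtain ⟨g, hg, hgp, hlt⟩ := hE.exists_norm_deriv_lt hU hc hp hfp (by simpa using hw) hwf
    rw [hsup] at hlt
    exact absurd (le_csSup hSbd ⟨g, hg, hgp, rfl⟩) (not_le.2 hlt)

/-! ### Inverse maps, change of variables and the area mean value property. -/

-- A nonzero strict derivative gives `map f (𝓝 z) = 𝓝 (f z)`, so continuity of the inverse can be
-- tested after composing with `f`.
open Filter Topology in
theorem continuousAt_invFunOn_of_deriv_ne_zero {U : Set ℂ} (hU : IsOpen U) {f : ℂ → ℂ}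
    (hf : DifferentiableOn ℂ f U) (hinj : InjOn f U) {z : ℂ} (hz : z ∈ U) (hd : deriv f z ≠ 0) :
    ContinuousAt (Function.invFunOn f U) (f z) := by
  have hs : HasStrictDerivAt f (deriv f z) z :=
    (hf.analyticAt (hU.mem_nhds hz)).hasStrictDerivAt
  have hl : LeftInvOn (Function.invFunOn f U) f U := hinj.leftInvOn_invFunOn
  rw [ContinuousAt, hl hz, ← hs.map_nhds_eq hd, tendsto_map'_iff]
  refine tendsto_id.congr' ?_
  filter_upwards [hU.mem_nhds hz] with x hx using (hl hx).symm

/-- The derivative of the inverse of an injective holomorphic map. -/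
theorem hasDerivAt_invFunOn {U : Set ℂ} (hU : IsOpen U) {f : ℂ → ℂ}
    (hf : DifferentiableOn ℂ f U) (hinj : InjOn f U) {z : ℂ} (hz : z ∈ U) (hd : deriv f z ≠ 0) :
    HasDerivAt (Function.invFunOn f U) (deriv f z)⁻¹ (f z) := by
  have hl : LeftInvOn (Function.invFunOn f U) f U := hinj.leftInvOn_invFunOn
  have hs : HasStrictDerivAt f (deriv f z) z :=
    (hf.analyticAt (hU.mem_nhds hz)).hasStrictDerivAt
  refine HasDerivAt.of_local_left_inverse (f := f)
    (continuousAt_invFunOn_of_deriv_ne_zero hU hf hinj hz hd) ?_ hd ?_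
  · rw [hl hz]; exact hs.hasDerivAt
  · rw [← hs.map_nhds_eq hd, Filter.eventually_map]
    filter_upwards [hU.mem_nhds hz] with x hx
    rw [hl hx]

/-- The real determinant of multiplication by `c` is the norm of `c` from ℂ to ℝ. -/
theorem abs_det_restrictScalars_toSpanSingleton (c : ℂ) :
    |(((ContinuousLinearMap.toSpanSingleton ℂ c).restrictScalars ℝ : ℂ →L[ℝ] ℂ)).det| =
      ‖c‖ ^ 2 := by
  have h : LinearMap.det (LinearMap.toSpanSingleton ℂ ℂ c) = c := by
    rw [LinearMap.det_ring]; simp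
  have h2 : ((((ContinuousLinearMap.toSpanSingleton ℂ c).restrictScalars ℝ : ℂ →L[ℝ] ℂ)) :
      ℂ →ₗ[ℝ] ℂ) = (LinearMap.toSpanSingleton ℂ ℂ c).restrictScalars ℝ := by
    ext; simp
  rw [ContinuousLinearMap.det, h2, LinearMap.det_restrictScalars, h, Algebra.norm_complex_eq]
  simp [Complex.normSq_eq_norm_sq]

/-- Change of variables under an injective holomorphic map. -/
theorem setIntegral_image_eq_of_injOn {U : Set ℂ} (hU : IsOpen U) {f : ℂ → ℂ}
    (hf : DifferentiableOn ℂ f U) (hinj : InjOn f U) (g : ℂ → ℂ) :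
    ∫ w in f '' U, g w = ∫ z in U, (‖deriv f z‖ ^ 2 : ℝ) • g (f z) := by
  rw [integral_image_eq_integral_abs_det_fderiv_smul volume hU.measurableSet
    (f' := fun z => (ContinuousLinearMap.toSpanSingleton ℂ (deriv f z)).restrictScalars ℝ)
    (fun z hz => ?_) hinj g]
  · simp only [abs_det_restrictScalars_toSpanSingleton]
  · exact ((hf.differentiableAt (hU.mem_nhds hz)).hasDerivAt.hasFDerivAt.restrictScalars
      ℝ).hasFDerivWithinAt

theorem integrableOn_image_iff_of_injOn {U : Set ℂ} (hU : IsOpen U) {f : ℂ → ℂ}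
    (hf : DifferentiableOn ℂ f U) (hinj : InjOn f U) {E : Type*} [NormedAddCommGroup E]
    [NormedSpace ℝ E] (g : ℂ → E) :
    IntegrableOn g (f '' U) ↔ IntegrableOn (fun z => (‖deriv f z‖ ^ 2 : ℝ) • g (f z)) U := by
  rw [integrableOn_image_iff_integrableOn_abs_det_fderiv_smul volume hU.measurableSet
    (f' := fun z => (ContinuousLinearMap.toSpanSingleton ℂ (deriv f z)).restrictScalars ℝ)
    (fun z hz => ?_) hinj g]
  · simp only [abs_det_restrictScalars_toSpanSingleton]
  · exact ((hf.differentiableAt (hU.mem_nhds hz)).hasDerivAt.hasFDerivAt.restrictScalars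
      ℝ).hasFDerivWithinAt

/-- Supplies the integrability needed for Fubini in polar coordinates. -/
theorem Complex.integrableOn_polarCoord_target {F : ℂ → ℂ} (hm : Measurable F)
    (hF : Integrable F) :
    IntegrableOn (fun q : ℝ × ℝ => q.1 • F (Complex.polarCoord.symm q)) polarCoord.target := by
  have hpm : Measurable fun q : ℝ × ℝ => Complex.polarCoord.symm q := by
    simp only [Complex.polarCoord_symm_apply]
    fun_prop
  refine ⟨(measurable_fst.smul (hm.comp hpm)).aestronglyMeasurable, ?_⟩
  have h := Complex.lintegral_comp_polarCoord_symm fun z => ‖F z‖ₑ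
  rw [HasFiniteIntegral]
  refine lt_of_eq_of_lt ?_ (h.trans_lt hF.hasFiniteIntegral)
  refine setLIntegral_congr_fun polarCoord.open_target.measurableSet fun q hq => ?_
  have hq1 : 0 < q.1 := by
    rw [polarCoord_target] at hq; exact hq.1
  simp only [enorm_smul, smul_eq_mul]
  rw [Real.enorm_eq_ofReal hq1.le]

-- The mean value property on a circle; periodicity moves the angles from [0, 2π] to the range (-π,
-- π) of polar coordinates.
open Complex in
theorem integral_Ioo_eq_of_differentiableOn_ball {G : ℂ → ℂ}
    (hG : DifferentiableOn ℂ G (Metric.ball 0 1)) {r : ℝ} (hr : 0 < r) (hr1 : r < 1) :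
    ∫ θ in Ioo (-Real.pi) Real.pi, G (Complex.polarCoord.symm (r, θ)) = (2 * Real.pi) • G 0 := by
  have hd : DiffContOnCl ℂ G (Metric.ball 0 |r|) := by
    refine DifferentiableOn.diffContOnCl (hG.mono ?_)
    rw [abs_of_pos hr, closure_ball _ hr.ne']
    exact Metric.closedBall_subset_ball hr1
  have h1 := hd.circleAverage
  rw [Real.circleAverage_def] at h1
  have hper : Function.Periodic (fun θ => G (circleMap 0 r θ)) (2 * Real.pi) := fun θ => by
    simp only [periodic_circleMap 0 r θ]
  have h2 := hper.intervalIntegral_add_eq 0 (-Real.pi)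
  rw [zero_add, show -Real.pi + 2 * Real.pi = Real.pi by ring] at h2
  have h3 : ∫ θ in Ioo (-Real.pi) Real.pi, G (Complex.polarCoord.symm (r, θ)) =
      ∫ θ in (-Real.pi)..Real.pi, G (circleMap 0 r θ) := by
    rw [intervalIntegral.integral_of_le (by linarith [Real.pi_pos]), integral_Ioc_eq_integral_Ioo]
    refine setIntegral_congr_fun measurableSet_Ioo fun θ _ => ?_
    simp only [Complex.polarCoord_symm_apply, circleMap, zero_add, Complex.exp_mul_I]
    push_cast
    rfl
  rw [h3, ← h2, ← h1, smul_smul, mul_inv_cancel₀ (by positivity), one_smul]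

/-- The mean value property over the unit disc with respect to area. -/
theorem integral_ball_eq_of_differentiableOn {G : ℂ → ℂ}
    (hG : DifferentiableOn ℂ G (Metric.ball 0 1)) (hi : IntegrableOn G (Metric.ball 0 1)) :
    ∫ z in Metric.ball 0 1, G z = Real.pi * G 0 := by
  classical
  set F := (Metric.ball (0 : ℂ) 1).indicator G with hF
  have hm : Measurable F := by
    rw [hF, ← piecewise_eq_indicator]
    exact hG.continuousOn.measurable_piecewise continuousOn_const Metric.isOpen_ball.measurableSet
  have hFi : Integrable F := hi.integrable_indicator Metric.isOpen_ball.measurableSet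
  rw [← integral_indicator Metric.isOpen_ball.measurableSet, ← hF,
    ← Complex.integral_comp_polarCoord_symm]
  have hpi := Complex.integrableOn_polarCoord_target hm hFi
  rw [polarCoord_target, Measure.volume_eq_prod] at *
  rw [setIntegral_prod _ hpi]
  have h1 : ∀ r ∈ Ioi (0 : ℝ), ∫ θ in Ioo (-Real.pi) Real.pi,
      (r, θ).1 • F (Complex.polarCoord.symm (r, θ)) =
      (Ioo (0 : ℝ) 1).indicator (fun r => ((2 * Real.pi) * r) • G 0) r := by
    intro r hr
    have hr0 : (0 : ℝ) < r := hr
    rw [integral_smul]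
    have hn : ∀ θ : ℝ, ‖Complex.polarCoord.symm (r, θ)‖ = r := fun θ => by
      rw [Complex.norm_polarCoord_symm, abs_of_pos hr0]
    by_cases hr1 : r < 1
    · have h2 : ∀ θ : ℝ, F (Complex.polarCoord.symm (r, θ)) =
          G (Complex.polarCoord.symm (r, θ)) := fun θ =>
        indicator_of_mem (by rw [mem_ball_zero_iff, hn]; exact hr1) _
      simp only [h2]
      rw [integral_Ioo_eq_of_differentiableOn_ball hG hr0 hr1, indicator_of_mem,
        smul_smul, mul_comm]
      exact mem_Ioo.2 ⟨hr0, hr1⟩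
    · have h2 : ∀ θ : ℝ, F (Complex.polarCoord.symm (r, θ)) = 0 := fun θ =>
        indicator_of_notMem (by rw [mem_ball_zero_iff, hn]; exact hr1) _
      simp only [h2]
      rw [indicator_of_notMem (fun h => hr1 h.2)]
      simp
  rw [setIntegral_congr_fun measurableSet_Ioi h1, setIntegral_indicator measurableSet_Ioo,
    inter_eq_self_of_subset_right (fun x hx => hx.1), integral_smul_const,
    ← integral_Ioc_eq_integral_Ioo, ← intervalIntegral.integral_of_le zero_le_one,
    intervalIntegral.integral_const_mul, integral_id, Complex.real_smul]
  push_cast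
  ring

/-! ### The Bergman kernel through the Riemann map. -/

open ComplexConjugate in
theorem integrable_mul_conj_of_mem_bergmanSpace {D : Set ℂ} {f k : ℂ → ℂ} (hf : f ∈ bergmanSpace D)
    (hk : k ∈ bergmanSpace D) : Integrable (fun z => f z * conj (k z)) (volume.restrict D) := by
  have h : MemLp (fun z => conj (k z)) 2 (volume.restrict D) := hk.2.star
  exact hf.2.integrable_mul h

open ComplexConjugate in
/-- The representing function of an evaluation is unique. -/
theorem IsBergmanReproducing.eqOn {D : Set ℂ} (hD : IsOpen D) {w : ℂ} {k₁ k₂ : ℂ → ℂ}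
    (h₁ : IsBergmanReproducing D w k₁) (h₂ : IsBergmanReproducing D w k₂) : EqOn k₁ k₂ D := by
  have hh : (fun z => k₁ z - k₂ z) ∈ bergmanSpace D := ⟨h₁.1.1.sub h₂.1.1, h₁.1.2.sub h₂.1.2⟩
  -- Pairing `k₁ - k₂` with `k₁` and with `k₂` gives the same number, its value at `w`.
  have e : ∫ z in D, (k₁ z - k₂ z) * conj (k₁ z - k₂ z) = 0 := by
    have e1 := h₁.2 _ hh
    rw [h₂.2 _ hh] at e1
    simp only [map_sub, mul_sub]
    rw [integral_sub (integrable_mul_conj_of_mem_bergmanSpace hh h₁.1)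
      (integrable_mul_conj_of_mem_bergmanSpace hh h₂.1), e1, sub_self]
  have e2 : ∫ z in D, ‖k₁ z - k₂ z‖ ^ 2 = 0 := by
    have : ∀ z, (k₁ z - k₂ z) * conj (k₁ z - k₂ z) = ((‖k₁ z - k₂ z‖ ^ 2 : ℝ) : ℂ) := fun z => by
      rw [Complex.mul_conj, Complex.normSq_eq_norm_sq]
    simp only [this] at e
    rw [integral_complex_ofReal] at e
    exact_mod_cast e
  rw [integral_eq_zero_iff_of_nonneg (fun z => by positivity)
    ((memLp_two_iff_integrable_sq_norm hh.2.1).1 hh.2)] at e2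
  have e3 : k₁ =ᵐ[volume.restrict D] k₂ := by
    filter_upwards [e2] with z hz
    simpa [sub_eq_zero] using hz
  exact Measure.eqOn_open_of_ae_eq e3 hD h₁.1.1.continuousOn h₂.1.1.continuousOn

/-- By uniqueness an explicit representing function computes the kernel, whichever witness `choose`
selects. -/
theorem IsBergmanReproducing.bergmanKernel_eq {D : Set ℂ} (hD : IsOpen D) {w z : ℂ} {k : ℂ → ℂ}
    (hk : IsBergmanReproducing D w k) (hz : z ∈ D) : bergmanKernel D z w = k z := by
  have h : ∃ k, IsBergmanReproducing D w k := ⟨k, hk⟩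
  rw [bergmanKernel, dif_pos h]
  exact h.choose_spec.eqOn hD hk hz

open ComplexConjugate in
/-- The function representing evaluation at `p` in terms of a conformal map onto the disc that
sends `p` to the centre. -/
theorem isBergmanReproducing_deriv_mul {D : Set ℂ} (hD : IsOpen D) {f : ℂ → ℂ}
    (hf : IsDiscEmbedding D f) (him : f '' D = Metric.ball 0 1) {p : ℂ} (hp : p ∈ D)
    (hfp : f p = 0) :
    IsBergmanReproducing D p fun z => deriv f z * (conj (deriv f p) / Real.pi) := by
  have hfd : DifferentiableOn ℂ (deriv f) D := hf.diff.deriv hD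
  have hsm : AEStronglyMeasurable (deriv f) (volume.restrict D) :=
    hfd.continuousOn.aestronglyMeasurable hD.measurableSet
  have hA : deriv f ∈ bergmanSpace D := by
    refine ⟨hfd, ?_⟩
    rw [memLp_two_iff_integrable_sq_norm hsm]
    -- The integral of |f'|² over `D` is the area of the image disc.
    have h1 : IntegrableOn (fun _ : ℂ => (1 : ℝ)) (f '' D) := by
      rw [him]
      exact integrableOn_const Metric.isBounded_ball.measure_lt_top.ne
    rw [integrableOn_image_iff_of_injOn hD hf.diff hf.inj] at h1
    simpa [IntegrableOn] using h1
  refine ⟨⟨hfd.mul_const _, hA.2.mul_const _⟩, fun h hh => ?_⟩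
  set ψ := Function.invFunOn f D with hψ
  have hl : LeftInvOn ψ f D := hf.inj.leftInvOn_invFunOn
  -- Chosen so that the Jacobian |f'|² turns `G ∘ f` into `h * conj f'`; the mean value of `G` then
  -- evaluates the pairing as π h(p) / f'(p).
  set G : ℂ → ℂ := fun w => h (ψ w) / deriv f (ψ w) with hG
  have hGd : DifferentiableOn ℂ G (Metric.ball 0 1) := by
    rw [← him]
    rintro _ ⟨z, hz, rfl⟩
    have h1 := (hasDerivAt_invFunOn hD hf.diff hf.inj hz (hf.deriv_ne z hz)).differentiableAt
    have h2 : DifferentiableAt ℂ h (ψ (f z)) := by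
      rw [hl hz]; exact hh.1.differentiableAt (hD.mem_nhds hz)
    have h3 : DifferentiableAt ℂ (deriv f) (ψ (f z)) := by
      rw [hl hz]; exact hfd.differentiableAt (hD.mem_nhds hz)
    refine DifferentiableAt.differentiableWithinAt ?_
    refine (h2.comp (f z) h1).div (h3.comp (f z) h1) ?_
    simp only [hl hz]
    exact hf.deriv_ne z hz
  have hcv : ∀ z ∈ D, (‖deriv f z‖ ^ 2 : ℝ) • G (f z) = h z * conj (deriv f z) := by
    intro z hz
    have h0 := hf.deriv_ne z hz
    simp only [hG, hl hz]
    rw [Complex.real_smul, ← Complex.normSq_eq_norm_sq, ← Complex.mul_conj]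
    field_simp
  have hGi : IntegrableOn G (Metric.ball 0 1) := by
    rw [← him, integrableOn_image_iff_of_injOn hD hf.diff hf.inj,
      integrableOn_congr_fun hcv hD.measurableSet]
    exact integrable_mul_conj_of_mem_bergmanSpace hh hA
  have key := integral_ball_eq_of_differentiableOn hGd hGi
  rw [← him, setIntegral_image_eq_of_injOn hD hf.diff hf.inj,
    setIntegral_congr_fun hD.measurableSet hcv] at key
  have hG0 : G 0 = h p / deriv f p := by
    rw [← hfp]; simp only [hG, hl hp]
  have h0 := hf.deriv_ne p hp
  have hpi : (Real.pi : ℂ) ≠ 0 := by exact_mod_cast Real.pi_ne_zero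
  simp only [map_mul, ← mul_assoc]
  rw [integral_mul_const, key, hG0]
  simp only [map_div₀, Complex.conj_conj, Complex.conj_ofReal]
  field_simp

theorem IsDiscEmbedding.image_diskMobius_comp {U : Set ℂ} {w : ℂ} (hw : ‖w‖ < 1) {f : ℂ → ℂ}
    (him : f '' U = Metric.ball 0 1) : (diskMobius w ∘ f) '' U = Metric.ball 0 1 := by
  rw [image_comp, him]
  refine Subset.antisymm ?_ ?_
  · rintro _ ⟨z, hz, rfl⟩
    simpa using norm_diskMobius_lt_one hw (by simpa using hz)
  · intro z hz
    have hw' : ‖-w‖ < 1 := by rwa [norm_neg]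
    have hz' : ‖z‖ < 1 := by simpa using hz
    refine ⟨diskMobius (-w) z, by simpa using norm_diskMobius_lt_one hw' hz', ?_⟩
    simpa using diskMobius_neg_diskMobius hw' hz'

open ComplexConjugate in
/-- The Bergman kernel in terms of a conformal map onto the unit disc. -/
theorem bergmanKernel_eq_of_isDiscEmbedding {D : Set ℂ} (hD : IsOpen D) {f : ℂ → ℂ}
    (hf : IsDiscEmbedding D f) (him : f '' D = Metric.ball 0 1) {z w : ℂ} (hz : z ∈ D)
    (hw : w ∈ D) :
    bergmanKernel D z w =
      deriv f z * conj (deriv f w) / Real.pi * ((1 - conj (f w) * f z) ^ 2)⁻¹ := by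
  have hfw := hf.norm_lt w hw
  -- Composing with `diskMobius (f w)` recentres the Riemann map at `w`; the factors 1 - |f(w)|² of
  -- the two derivatives cancel.
  rw [(isBergmanReproducing_deriv_mul hD (hf.comp_diskMobius hD hfw)
    (IsDiscEmbedding.image_diskMobius_comp hfw him) hw (diskMobius_self _)).bergmanKernel_eq hD hz,
    hf.deriv_diskMobius_comp hD hfw hz, hf.deriv_diskMobius_comp hD hfw hw]
  have h1 := one_sub_conj_mul_ne_zero hfw (hf.norm_lt z hz)
  have h2 := one_sub_conj_mul_ne_zero hfw hfw
  have hpi : (Real.pi : ℂ) ≠ 0 := by exact_mod_cast Real.pi_ne_zero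
  simp only [map_mul, map_div₀, map_pow, map_sub, map_one, Complex.conj_conj]
  rw [mul_comm (f w) (conj (f w))]
  field_simp

/-! ### Wirtinger calculus: the metric and the representative coordinate. -/

section

open ComplexConjugate

/-- `f` is real differentiable at `z` with Wirtinger derivatives `a = ∂f/∂z` and
`b = ∂f/∂z̄`. -/
def HasWirtingerAt (f : ℂ → ℂ) (a b z : ℂ) : Prop :=
  HasFDerivAt f (a • ContinuousLinearMap.id ℝ ℂ + b • (Complex.conjCLE : ℂ →L[ℝ] ℂ)) z

namespace HasWirtingerAt

variable {f g h : ℂ → ℂ} {a b c d e z : ℂ}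

theorem dz (hf : HasWirtingerAt f a b z) : wirtingerDz f z = a := by
  rw [wirtingerDz, HasFDerivAt.fderiv hf]
  simp
  linear_combination ((b - a) / 2) * Complex.I_sq

theorem dzbar (hf : HasWirtingerAt f a b z) : wirtingerDzbar f z = b := by
  rw [wirtingerDzbar, HasFDerivAt.fderiv hf]
  simp
  linear_combination ((a - b) / 2) * Complex.I_sq

theorem of_hasDerivAt (hf : HasDerivAt f a z) : HasWirtingerAt f a 0 z := by
  have h1 := hf.hasFDerivAt.restrictScalars ℝ
  refine h1.congr_fderiv ?_
  ext x
  simp [mul_comm]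

theorem comp (hg : HasDerivAt g c (f z)) (hf : HasWirtingerAt f a b z) :
    HasWirtingerAt (fun x => g (f x)) (c * a) (c * b) z := by
  have h1 := (hg.hasFDerivAt.restrictScalars ℝ).comp z hf
  refine h1.congr_fderiv ?_
  ext x
  simp
  ring

theorem conj_of_hasDerivAt (hf : HasDerivAt f a z) :
    HasWirtingerAt (fun x => conj (f x)) 0 (conj a) z := by
  have h1 := (Complex.conjCLE : ℂ →L[ℝ] ℂ).hasFDerivAt.comp z (hf.hasFDerivAt.restrictScalars ℝ)
  refine h1.congr_fderiv ?_
  ext x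
  simp [mul_comm]

theorem mul (hf : HasWirtingerAt f a b z) (hg : HasWirtingerAt g c d z) :
    HasWirtingerAt (fun x => f x * g x) (a * g z + f z * c) (b * g z + f z * d) z := by
  have h1 := HasFDerivAt.mul hf hg
  refine h1.congr_fderiv ?_
  ext x
  simp
  ring

theorem add (hf : HasWirtingerAt f a b z) (hg : HasWirtingerAt g c d z) :
    HasWirtingerAt (fun x => f x + g x) (a + c) (b + d) z := by
  have h1 := HasFDerivAt.add hf hg
  refine h1.congr_fderiv ?_
  ext x
  simp
  ring

theorem const_mul (hf : HasWirtingerAt f a b z) (k : ℂ) :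
    HasWirtingerAt (fun x => k * f x) (k * a) (k * b) z := by
  have h1 := HasFDerivAt.const_mul hf k
  refine h1.congr_fderiv ?_
  ext x
  simp
  ring

open Filter Topology in
theorem congr (hf : HasWirtingerAt f a b z) (hfg : g =ᶠ[𝓝 z] f) : HasWirtingerAt g a b z :=
  HasFDerivAt.congr_of_eventuallyEq hf hfg

end HasWirtingerAt

variable {D : Set ℂ} {f : ℂ → ℂ} {p t z : ℂ}

/-- In `t` the kernel is a constant times the conjugate of the holomorphic function f'(t) / (1 -
f(t) conj(f(z)))². -/
theorem hasWirtingerAt_bergmanKernel_right (hD : IsOpen D) (hf : IsDiscEmbedding D f)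
    (him : f '' D = Metric.ball 0 1) (hp : p ∈ D) (hfp : f p = 0) (hz : z ∈ D) :
    HasWirtingerAt (fun t => bergmanKernel D z t) 0 (deriv f z / Real.pi *
      (conj (deriv (deriv f) p) + 2 * conj (deriv f p) ^ 2 * f z)) p := by
  have h1 : HasDerivAt f (deriv f p) p := (hf.diff.differentiableAt (hD.mem_nhds hp)).hasDerivAt
  have h2 : HasDerivAt (deriv f) (deriv (deriv f) p) p :=
    ((hf.diff.deriv hD).differentiableAt (hD.mem_nhds hp)).hasDerivAt
  have h3 : HasDerivAt (fun t => ((1 - f t * conj (f z)) ^ 2))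
      (-(2 * deriv f p * conj (f z))) p := by
    convert! ((h1.mul_const (conj (f z))).const_sub 1).pow 2 using 1
    rw [hfp]; norm_num; ring
  have h4 := h2.fun_div h3 (by rw [hfp]; simp)
  have h5 := (HasWirtingerAt.conj_of_hasDerivAt h4).const_mul (deriv f z / Real.pi)
  rw [hfp] at h5
  have h6 : HasWirtingerAt (fun t => bergmanKernel D z t) _ _ p := h5.congr ?_
  · convert! h6 using 1
    · simp
    · simp
      left
      rw [show conj (2 : ℂ) = 2 from map_ofNat _ 2]
      ring
  · filter_upwards [hD.mem_nhds hp] with t ht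
    rw [bergmanKernel_eq_of_isDiscEmbedding hD hf him hz ht]
    simp [div_eq_mul_inv]
    ring

theorem bergmanKernel_self_mem_slitPlane (hD : IsOpen D) (hf : IsDiscEmbedding D f)
    (him : f '' D = Metric.ball 0 1) (ht : t ∈ D) :
    bergmanKernel D t t ∈ Complex.slitPlane := by
  rw [bergmanKernel_eq_of_isDiscEmbedding hD hf him ht ht, Complex.mul_conj, mul_comm _ (f t),
    Complex.mul_conj]
  have h1 : Complex.normSq (f t) < 1 := by
    have := hf.norm_lt t ht
    rw [← Complex.sq_norm]; nlinarith [norm_nonneg (f t)]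
  have h2 : 0 < Complex.normSq (deriv f t) := Complex.normSq_pos.2 (hf.deriv_ne t ht)
  have h3 : 0 < Complex.normSq (deriv f t) / Real.pi * ((1 - Complex.normSq (f t)) ^ 2)⁻¹ := by
    have := sub_pos.2 h1
    have := Real.pi_pos
    positivity
  exact_mod_cast Complex.ofReal_mem_slitPlane.2 h3

theorem hasWirtingerAt_mul_conj (hD : IsOpen D) (hf : IsDiscEmbedding D f) (ht : t ∈ D) :
    HasWirtingerAt (fun t => conj (f t) * f t) (conj (f t) * deriv f t)
      (conj (deriv f t) * f t) t := by
  have h1 : HasDerivAt f (deriv f t) t := (hf.diff.differentiableAt (hD.mem_nhds ht)).hasDerivAt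
  convert! (HasWirtingerAt.conj_of_hasDerivAt h1).mul (HasWirtingerAt.of_hasDerivAt h1) using 1
  · ring
  · ring

/-- Formally log K(t,t) = log|f'|² - 2 log(1 - |f|²) - log π. The formula is needed at every `t`
because the metric differentiates it again. -/
theorem wirtingerDzbar_logBergmanDiag (hD : IsOpen D) (hf : IsDiscEmbedding D f)
    (him : f '' D = Metric.ball 0 1) (ht : t ∈ D) :
    wirtingerDzbar (logBergmanDiag D) t = conj (deriv (deriv f) t / deriv f t) +
      f t * (2 * conj (deriv f t) * (1 - conj (f t) * f t)⁻¹) := by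
  have h2 : HasDerivAt (deriv f) (deriv (deriv f) t) t :=
    ((hf.diff.deriv hD).differentiableAt (hD.mem_nhds ht)).hasDerivAt
  have hs := one_sub_conj_mul_ne_zero (hf.norm_lt t ht) (hf.norm_lt t ht)
  have hq : HasDerivAt (fun s : ℂ => ((1 - s) ^ 2)⁻¹) (2 / (1 - conj (f t) * f t) ^ 3)
      (conj (f t) * f t) := by
    convert! (((hasDerivAt_id (conj (f t) * f t)).const_sub 1).pow 2).inv
      (pow_ne_zero 2 hs) using 1
    simp
    field_simp
  have hk := (((HasWirtingerAt.of_hasDerivAt h2).mul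
    (HasWirtingerAt.conj_of_hasDerivAt h2)).const_mul (Real.pi : ℂ)⁻¹).mul
    (HasWirtingerAt.comp hq (hasWirtingerAt_mul_conj hD hf ht))
  have hk2 : HasWirtingerAt (fun t => bergmanKernel D t t) _ _ t := hk.congr (by
    filter_upwards [hD.mem_nhds ht] with x hx
    rw [bergmanKernel_eq_of_isDiscEmbedding hD hf him hx hx]
    ring)
  have hl := HasWirtingerAt.comp (f := fun t => bergmanKernel D t t)
    (Complex.hasDerivAt_log (bergmanKernel_self_mem_slitPlane hD hf him ht)) hk2
  change wirtingerDzbar (fun t => Complex.log (bergmanKernel D t t)) t = _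
  rw [hl.dzbar, bergmanKernel_eq_of_isDiscEmbedding hD hf him ht ht]
  have h0 := hf.deriv_ne t ht
  have h0' : conj (deriv f t) ≠ 0 := (map_ne_zero _).2 h0
  have hpi : (Real.pi : ℂ) ≠ 0 := by exact_mod_cast Real.pi_ne_zero
  simp only [map_div₀]
  field_simp
  ring

/-- The antiholomorphic summand is killed by ∂/∂z; of the other one, only the term differentiating
the outer factor `f` survives where `f p = 0`. -/
theorem bergmanMetric_eq_of_isDiscEmbedding (hD : IsOpen D) (hf : IsDiscEmbedding D f)
    (him : f '' D = Metric.ball 0 1) (hp : p ∈ D) (hfp : f p = 0) :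
    bergmanMetric D p = 2 * ‖deriv f p‖ ^ 2 := by
  have h1 : HasDerivAt f (deriv f p) p := (hf.diff.differentiableAt (hD.mem_nhds hp)).hasDerivAt
  have h2 : HasDerivAt (deriv f) (deriv (deriv f) p) p :=
    ((hf.diff.deriv hD).differentiableAt (hD.mem_nhds hp)).hasDerivAt
  have h3 : HasDerivAt (deriv (deriv f)) (deriv (deriv (deriv f)) p) p :=
    (((hf.diff.deriv hD).deriv hD).differentiableAt (hD.mem_nhds hp)).hasDerivAt
  have hs := one_sub_conj_mul_ne_zero (hf.norm_lt p hp) (hf.norm_lt p hp)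
  have hq : HasDerivAt (fun s : ℂ => (1 - s)⁻¹) (1 / (1 - conj (f p) * f p) ^ 2)
      (conj (f p) * f p) := by
    convert! ((hasDerivAt_id (conj (f p) * f p)).const_sub 1).inv hs using 1
    simp
  have hm := (HasWirtingerAt.conj_of_hasDerivAt (h3.fun_div h2 (hf.deriv_ne p hp))).add
    ((HasWirtingerAt.of_hasDerivAt h1).mul
      (((HasWirtingerAt.conj_of_hasDerivAt h2).const_mul 2).mul
        (HasWirtingerAt.comp hq (hasWirtingerAt_mul_conj hD hf hp))))
  have hm2 : HasWirtingerAt (fun z => wirtingerDzbar (logBergmanDiag D) z) _ _ p := hm.congr (by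
    filter_upwards [hD.mem_nhds hp] with x hx
    exact wirtingerDzbar_logBergmanDiag hD hf him hx)
  rw [bergmanMetric, hm2.dz, hfp]
  have e : (0 : ℂ) + (deriv f p * (2 * conj (deriv f p) * (1 - conj 0 * 0)⁻¹) + 0 *
      (2 * 0 * (1 - conj 0 * 0)⁻¹ + 2 * conj (deriv f p) *
        (1 / (1 - conj 0 * 0) ^ 2 * (conj 0 * deriv f p)))) =
      ((2 * ‖deriv f p‖ ^ 2 : ℝ) : ℂ) := by
    rw [← Complex.normSq_eq_norm_sq]
    push_cast
    rw [← Complex.mul_conj]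
    simp
    ring
  rw [e, Complex.ofReal_re]

/-- The Bergman representative coordinate is the normalized Riemann map. -/
theorem bergmanCoord_eq_of_isDiscEmbedding (hD : IsOpen D) (hf : IsDiscEmbedding D f)
    (him : f '' D = Metric.ball 0 1) (hp : p ∈ D) (hfp : f p = 0) (hz : z ∈ D) :
    bergmanCoord D p z = f z / deriv f p := by
  -- The logarithmic derivative of the kernel is conj(f''(p)/f'(p)) + 2 conj(f'(p)) f(z); the
  -- subtracted term removes the first summand.
  rw [bergmanCoord, (hasWirtingerAt_bergmanKernel_right hD hf him hp hfp hz).dzbar,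
    wirtingerDzbar_logBergmanDiag hD hf him hp, bergmanMetric_eq_of_isDiscEmbedding hD hf him hp hfp,
    bergmanKernel_eq_of_isDiscEmbedding hD hf him hz hp, hfp, ← Complex.normSq_eq_norm_sq]
  push_cast
  rw [← Complex.mul_conj]
  have h0 := hf.deriv_ne p hp
  have h1 := hf.deriv_ne z hz
  have h0' : conj (deriv f p) ≠ 0 := (map_ne_zero _).2 h0
  have hpi : (Real.pi : ℂ) ≠ 0 := by exact_mod_cast Real.pi_ne_zero
  simp only [map_div₀, map_zero, zero_mul, sub_zero, one_pow, inv_one, mul_one, add_zero]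
  field_simp
  ring

theorem norm_bergmanKernel_eq_of_isDiscEmbedding (hD : IsOpen D) (hf : IsDiscEmbedding D f)
    (him : f '' D = Metric.ball 0 1) (hp : p ∈ D) (hfp : f p = 0) (hz : z ∈ D) :
    ‖bergmanKernel D z p‖ = ‖deriv f z‖ * ‖deriv f p‖ / Real.pi := by
  rw [bergmanKernel_eq_of_isDiscEmbedding hD hf him hz hp, hfp]
  simp [abs_of_pos Real.pi_pos]

end

/-! ### Boundary behaviour. -/

section

open Metric Filter Topology

open scoped ENNReal in
/-- A holomorphic function with derivative bounded by `C` increases lengths of paths at most by the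
factor `C`. -/
theorem edist_le_mul_eVariationOn_of_norm_deriv_le {D : Set ℂ} (hD : IsOpen D) {f : ℂ → ℂ}
    (hf : DifferentiableOn ℂ f D) {C : ℝ} (hC : 0 ≤ C) (hb : ∀ z ∈ D, ‖deriv f z‖ ≤ C)
    {γ : ℝ → ℂ} (hγ : ContinuousOn γ (Icc 0 1)) (hγD : MapsTo γ (Icc 0 1) D) :
    edist (f (γ 0)) (f (γ 1)) ≤ ENNReal.ofReal C * eVariationOn γ (Icc 0 1) := by
  -- The compact path has a tube inside `D`; a fine partition keeps each step in a ball of the tube,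
  -- where convexity allows the mean value inequality.
  obtain ⟨ρ, hρ, hρD⟩ := (isCompact_Icc.image_of_continuousOn hγ).exists_thickening_subset_open hD
    hγD.image_subset
  obtain ⟨δ, hδ, hu⟩ := Metric.uniformContinuousOn_iff.1
    (isCompact_Icc.uniformContinuousOn_of_continuous hγ) ρ hρ
  obtain ⟨N, hN⟩ := exists_nat_one_div_lt hδ
  set u : ℕ → ℝ := fun i => i / ((N + 1 : ℕ) : ℝ) with hudef
  have hN0 : (0 : ℝ) < ((N + 1 : ℕ) : ℝ) := by positivity
  have humem : ∀ i ≤ N + 1, u i ∈ Icc (0 : ℝ) 1 := fun i hi =>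
    ⟨by positivity, (div_le_one hN0).2 (by exact_mod_cast hi)⟩
  have hmono : MonotoneOn u (Iic (N + 1)) := fun i _ j _ hij => by
    simp only [hudef]
    gcongr
  have hstep : ∀ i < N + 1, edist (f (γ (u i))) (f (γ (u (i + 1)))) ≤
      ENNReal.ofReal C * edist (γ (u (i + 1))) (γ (u i)) := by
    intro i hi
    have h1 := humem i hi.le
    have h2 := humem (i + 1) hi
    have h3 : dist (u (i + 1)) (u i) < δ := by
      have : u (i + 1) - u i = 1 / ((N : ℝ) + 1) := by
        simp only [hudef]; push_cast; field_simp; ring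
      rw [Real.dist_eq, this, abs_of_pos (by positivity)]
      exact hN
    have h4 := hu _ h2 _ h1 h3
    have hsub : ball (γ (u i)) ρ ⊆ D := fun z hz =>
      hρD (mem_thickening_iff.2 ⟨_, mem_image_of_mem γ h1, hz⟩)
    have h5 := (convex_ball (γ (u i)) ρ).norm_image_sub_le_of_norm_deriv_le (𝕜 := ℂ)
      (fun z hz => hf.differentiableAt (hD.mem_nhds (hsub hz))) (fun z hz => hb z (hsub hz))
      (mem_ball_self hρ) h4
    rw [← dist_eq_norm, ← dist_eq_norm] at h5
    rw [edist_comm, edist_dist, edist_dist, ← ENNReal.ofReal_mul hC]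
    exact ENNReal.ofReal_le_ofReal h5
  have h0 : u 0 = 0 := by simp [hudef]
  have h1 : u (N + 1) = 1 := div_self hN0.ne'
  calc edist (f (γ 0)) (f (γ 1)) = edist (f (γ (u 0))) (f (γ (u (N + 1)))) := by rw [h0, h1]
    _ ≤ ∑ i ∈ Finset.range (N + 1), edist (f (γ (u i))) (f (γ (u (i + 1)))) :=
        edist_le_range_sum_edist (fun i => f (γ (u i))) (N + 1)
    _ ≤ ∑ i ∈ Finset.range (N + 1), ENNReal.ofReal C * edist (γ (u (i + 1))) (γ (u i)) :=
        Finset.sum_le_sum fun i hi => hstep i (Finset.mem_range.1 hi)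
    _ = ENNReal.ofReal C * ∑ i ∈ Finset.range (N + 1), edist (γ (u (i + 1))) (γ (u i)) := by
        rw [Finset.mul_sum]
    _ ≤ _ := by
        gcongr
        exact eVariationOn.sum_le_of_monotoneOn_Iic hmono humem

/-- On a domain that is locally `C¹`-connected around its boundary points, a holomorphic function
with bounded derivative extends continuously to the closure. -/
theorem exists_continuousOn_closure_of_norm_deriv_le {D : Set ℂ} (hD : IsOpen D)
    (hconn : ∀ q ∈ frontier D, LocallyC1ConnectedAround D q) {f : ℂ → ℂ}
    (hf : DifferentiableOn ℂ f D) {C : ℝ} (hb : ∀ z ∈ D, ‖deriv f z‖ ≤ C) :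
    ∃ F : ℂ → ℂ, ContinuousOn F (closure D) ∧ EqOn F f D := by
  refine ⟨extendFrom D f, continuousOn_extendFrom le_rfl fun x hx => ?_,
    fun x hx => extendFrom_extends hf.continuousOn x hx⟩
  by_cases hxD : x ∈ D
  · exact ⟨f x, hf.continuousOn x hxD⟩
  have hfr : x ∈ frontier D := by rw [hD.frontier_eq]; exact ⟨hx, hxD⟩
  have : (𝓝[D] x).NeBot := mem_closure_iff_nhdsWithin_neBot.1 hx
  rw [← cauchy_map_iff_exists_tendsto, Metric.cauchy_iff]
  refine ⟨inferInstance, fun ε hε => ?_⟩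
  -- Guarantees a positive constant to divide by.
  set C' := max C 1 with hC'
  have hC'0 : 0 < C' := lt_of_lt_of_le one_pos (le_max_right _ _)
  obtain ⟨V, hV, hxV, hpath⟩ := hconn x hfr (ε / C') (by positivity)
  refine ⟨f '' (V ∩ D), image_mem_map (inter_mem (mem_nhdsWithin_of_mem_nhds (hV.mem_nhds hxV))
    self_mem_nhdsWithin), ?_⟩
  rintro _ ⟨a, ha, rfl⟩ _ ⟨b, hb', rfl⟩
  obtain ⟨γ, hγ, hγD, rfl, rfl, hlen⟩ := hpath a ha b hb'
  have h1 := edist_le_mul_eVariationOn_of_norm_deriv_le hD hf hC'0.le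
    (fun z hz => (hb z hz).trans (le_max_left _ _)) hγ.1 hγD
  have h2 : ENNReal.ofReal C' * eVariationOn γ (Icc 0 1) < ENNReal.ofReal ε := by
    calc ENNReal.ofReal C' * eVariationOn γ (Icc 0 1)
        < ENNReal.ofReal C' * ENNReal.ofReal (ε / C') :=
          ENNReal.mul_lt_mul_right (by simpa using hC'0) ENNReal.ofReal_ne_top hlen
      _ = ENNReal.ofReal ε := by
          rw [← ENNReal.ofReal_mul hC'0.le]; congr 1; field_simp
  have h3 := h1.trans_lt h2
  rw [edist_dist] at h3
  exact (ENNReal.ofReal_lt_ofReal_iff hε).1 h3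

/-- An extension of a homeomorphism from a disc onto an open set to the closed disc maps the
boundary circle onto the boundary. -/
theorem image_sphere_eq_frontier {D : Set ℂ} (hD : IsOpen D) {r : ℝ} (hr : 0 < r) {T S : ℂ → ℂ}
    (hT : ContinuousOn T D) (hTm : MapsTo T D (ball 0 r)) (hSm : MapsTo S (ball 0 r) D)
    (hinv : InvOn S T D (ball 0 r)) (hS : ContinuousOn S (closedBall 0 r)) :
    S '' sphere 0 r = frontier D := by
  have hcl : closure (ball (0 : ℂ) r) = closedBall 0 r := closure_ball 0 hr.ne'
  have hsub : closure D ⊆ S '' closedBall 0 r := by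
    refine closure_minimal (fun z hz => ⟨T z, ball_subset_closedBall (hTm hz), hinv.1 hz⟩) ?_
    exact ((isCompact_closedBall 0 r).image_of_continuousOn hS).isClosed
  have hSc : MapsTo S (closedBall 0 r) (closure D) := by
    rw [← hcl] at hS ⊢
    exact hSm.closure_of_continuousOn hS
  rw [hD.frontier_eq]
  refine Subset.antisymm ?_ ?_
  · rintro _ ⟨w, hw, rfl⟩
    refine ⟨hSc (sphere_subset_closedBall hw), fun hwD => ?_⟩
    have hwc : w ∈ closure (ball (0 : ℂ) r) := by rw [hcl]; exact sphere_subset_closedBall hw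
    have : (𝓝[ball 0 r] w).NeBot := mem_closure_iff_nhdsWithin_neBot.1 hwc
    have h1 : Tendsto S (𝓝[ball 0 r] w) (𝓝[D] (S w)) :=
      tendsto_nhdsWithin_iff.2 ⟨(hS w (sphere_subset_closedBall hw)).mono_left
        (nhdsWithin_mono _ ball_subset_closedBall),
        eventually_of_mem self_mem_nhdsWithin fun x hx => hSm hx⟩
    -- If `S w` lay in `D`, continuity of `T` would give `T (S w) = w`, a point of the circle,
    -- although `T` maps `D` into the open ball.
    have h2 : Tendsto (T ∘ S) (𝓝[ball 0 r] w) (𝓝 (T (S w))) := (hT _ hwD).tendsto.comp h1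
    have h3 : Tendsto (T ∘ S) (𝓝[ball 0 r] w) (𝓝 w) := by
      refine Tendsto.congr' ?_ (tendsto_id.mono_left nhdsWithin_le_nhds)
      exact eventually_of_mem self_mem_nhdsWithin fun x hx => (hinv.2 hx).symm
    have h4 := hTm hwD
    rw [tendsto_nhds_unique h2 h3] at h4
    rw [mem_ball] at h4
    rw [mem_sphere] at hw
    exact h4.ne hw
  · rintro x ⟨hx, hxD⟩
    obtain ⟨w, hw, rfl⟩ := hsub hx
    refine ⟨w, ?_, rfl⟩
    by_contra hws
    refine hxD (hSm ?_)
    rw [mem_ball]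
    exact lt_of_le_of_ne hw hws

/-- The parametrization of the circle of radius `r` by the unit circle. -/
theorem range_mul_circle {r : ℝ} (hr : 0 < r) :
    range (fun c : Circle => (r : ℂ) * c) = sphere 0 r := by
  refine Subset.antisymm ?_ ?_
  · rintro _ ⟨c, rfl⟩
    simp [abs_of_pos hr, Circle.norm_coe]
  · intro w hw
    have hw' : ‖w‖ = r := by simpa using hw
    have hrC : (r : ℂ) ≠ 0 := by exact_mod_cast hr.ne'
    refine ⟨⟨w / r, ?_⟩, ?_⟩
    · change w / r ∈ sphere (0 : ℂ) 1
      rw [mem_sphere_zero_iff_norm, norm_div, hw', Complex.norm_real, Real.norm_eq_abs,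
        abs_of_pos hr, div_self hr.ne']
    · simp only
      field_simp

/-- Local path connectedness passes from ℝ to its quotient. -/
theorem locallyPathConnectedSpace_circle : LocallyPathConnectedSpace Circle :=
  have : LocallyPathConnectedSpace (AddCircle (2 * Real.pi)) :=
    (QuotientAddGroup.isQuotientMap_mk _).locallyPathConnectedSpace
  AddCircle.homeomorphCircle'.isQuotientMap.locallyPathConnectedSpace

/-- A continuous image of a circle is locally connected. -/
theorem locallyConnectedSpace_image_sphere {r : ℝ} (hr : 0 < r) {S : ℂ → ℂ}
    (hS : ContinuousOn S (sphere 0 r)) : LocallyConnectedSpace (S '' sphere 0 r) := by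
  have := locallyPathConnectedSpace_circle
  have hmem : ∀ c : Circle, (r : ℂ) * c ∈ sphere (0 : ℂ) r := fun c => by
    rw [← range_mul_circle hr]; exact mem_range_self c
  let g : Circle → S '' sphere 0 r := fun c => ⟨S (r * c), mem_image_of_mem S (hmem c)⟩
  have hg : Continuous g := by
    refine Continuous.subtype_mk ?_ _
    exact hS.comp_continuous (by fun_prop) hmem
  have hsurj : Function.Surjective g := by
    rintro ⟨_, w, hw, rfl⟩
    rw [← range_mul_circle hr] at hw
    obtain ⟨c, rfl⟩ := hw
    exact ⟨c, rfl⟩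
  -- A continuous surjection from a compact space to a Hausdorff space is a quotient map.
  have := (hg.isClosedMap.isQuotientMap hg hsurj).locallyPathConnectedSpace
  infer_instance

end

/-! ### Extensions of the coordinate and its inverse; the theorem. -/

section

variable {D : Set ℂ} {f : ℂ → ℂ} {p : ℂ}

theorem bergmanDisc_eq_ball (hD : IsOpen D) (hf : IsDiscEmbedding D f)
    (him : f '' D = Metric.ball 0 1) (hp : p ∈ D) (hfp : f p = 0) :
    bergmanDisc D p = Metric.ball 0 (‖deriv f p‖⁻¹) := by
  have h0 : 0 < ‖deriv f p‖ := norm_pos_iff.2 (hf.deriv_ne p hp)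
  ext w
  rw [bergmanDisc, mem_ofPred_eq, bergmanMetric_eq_of_isDiscEmbedding hD hf him hp hfp,
    mem_ball_zero_iff, show (2 : ℝ) / (2 * ‖deriv f p‖ ^ 2) = (‖deriv f p‖⁻¹) ^ 2 by field_simp]
  exact pow_lt_pow_iff_left₀ (norm_nonneg _) (by positivity) two_ne_zero

theorem isBiholomorphicWithInv_bergmanCoord (hD : IsOpen D) (hf : IsDiscEmbedding D f)
    (him : f '' D = Metric.ball 0 1) (hp : p ∈ D) (hfp : f p = 0) :
    IsBiholomorphicWithInv (bergmanCoord D p) (fun w => Function.invFunOn f D (deriv f p * w)) D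
      (bergmanDisc D p) := by
  have h0 := hf.deriv_ne p hp
  have h0' : 0 < ‖deriv f p‖ := norm_pos_iff.2 h0
  have hT : EqOn (bergmanCoord D p) (fun z => f z / deriv f p) D := fun z hz =>
    bergmanCoord_eq_of_isDiscEmbedding hD hf him hp hfp hz
  have hl : LeftInvOn (Function.invFunOn f D) f D := hf.inj.leftInvOn_invFunOn
  rw [bergmanDisc_eq_ball hD hf him hp hfp]
  have hmem : ∀ w ∈ Metric.ball (0 : ℂ) (‖deriv f p‖⁻¹), ∃ z ∈ D, f z = deriv f p * w := by
    intro w hw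
    rw [mem_ball_zero_iff] at hw
    have h1 : deriv f p * w ∈ f '' D := by
      rw [him, mem_ball_zero_iff, norm_mul, ← mul_inv_cancel₀ h0'.ne']
      exact mul_lt_mul_of_pos_left hw h0'
    exact h1
  refine ⟨(hf.diff.div_const _).congr hT, ?_, ?_, ?_, ?_, ?_⟩
  · intro w hw
    obtain ⟨z, hz, hzw⟩ := hmem w hw
    have h1 := hasDerivAt_invFunOn hD hf.diff hf.inj hz (hf.deriv_ne z hz)
    rw [hzw] at h1
    have h2 : DifferentiableAt ℂ (fun w => deriv f p * w) w := by fun_prop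
    exact (h1.differentiableAt.comp w h2).differentiableWithinAt
  · intro z hz
    rw [hT hz, mem_ball_zero_iff, norm_div, div_eq_mul_inv]
    exact mul_lt_of_lt_one_left (by positivity) (hf.norm_lt z hz)
  · intro w hw
    obtain ⟨z, hz, hzw⟩ := hmem w hw
    simp only [← hzw, hl hz, hz]
  · intro z hz
    simp only [hT hz, mul_div_cancel₀ _ h0, hl hz]
  · intro w hw
    obtain ⟨z, hz, hzw⟩ := hmem w hw
    simp only [← hzw, hl hz, hT hz]
    rw [hzw, mul_div_cancel_left₀ _ h0]

/-- The bound concerns K(·,p₀), so the Riemann map centred at `p₀` is extended and then recentred at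
`p`. The Möbius denominator does not vanish, since |F| ≤ 1 on the closure and |a| < 1. -/
theorem exists_extension_bergmanCoord (hD : IsOpen D) (hb : Bornology.IsBounded D)
    (hsc : IsSimplyConnected D) (hp : p ∈ D) (hU : BergmanUpperCondition D) :
    ∃ T' : ℂ → ℂ, ContinuousOn T' (closure D) ∧ EqOn T' (bergmanCoord D p) D := by
  obtain ⟨hconn, p₀, hp₀, C, hC, hK⟩ := hU
  obtain ⟨f, hf, hfp, him⟩ := exists_isDiscEmbedding_image_eq_ball hD hb hsc hp₀
  have h0 : 0 < ‖deriv f p₀‖ := norm_pos_iff.2 (hf.deriv_ne p₀ hp₀)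
  have hbd : ∀ z ∈ D, ‖deriv f z‖ ≤ C * Real.pi / ‖deriv f p₀‖ := by
    intro z hz
    have h1 := hK z hz
    rw [norm_bergmanKernel_eq_of_isDiscEmbedding hD hf him hp₀ hfp hz,
      div_le_iff₀ Real.pi_pos] at h1
    rwa [le_div_iff₀ h0]
  obtain ⟨F, hF, hFe⟩ := exists_continuousOn_closure_of_norm_deriv_le hD hconn hf.diff hbd
  have hF1 : ∀ z ∈ closure D, ‖F z‖ ≤ 1 := by
    intro z hz
    have h1 : MapsTo F D (Metric.closedBall 0 1) := fun x hx => by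
      rw [hFe hx]; simpa using (hf.norm_lt x hx).le
    have h2 := h1.closure_of_continuousOn hF hz
    rw [Metric.isClosed_closedBall.closure_eq] at h2
    simpa using h2
  set a := f p with ha
  have ha1 : ‖a‖ < 1 := hf.norm_lt p hp
  have hE := hf.comp_diskMobius hD ha1
  refine ⟨fun z => diskMobius a (F z) / deriv (diskMobius a ∘ f) p, ?_, fun z hz => ?_⟩
  · refine ContinuousOn.div_const ?_ _
    refine (hF.sub continuousOn_const).div (continuousOn_const.sub (hF.const_mul _)) ?_
    intro z hz h
    have h1 : ‖(starRingEnd ℂ) a * F z‖ = 1 := by rw [← sub_eq_zero.1 h, norm_one]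
    rw [norm_mul, RCLike.norm_conj] at h1
    nlinarith [norm_nonneg a, norm_nonneg (F z), hF1 z hz]
  · rw [bergmanCoord_eq_of_isDiscEmbedding hD hE (IsDiscEmbedding.image_diskMobius_comp ha1 him) hp
      (diskMobius_self _) hz]
    simp only [hFe hz, Function.comp]

theorem exists_extension_bergmanCoord_inv (hD : IsOpen D) (hb : Bornology.IsBounded D)
    (hsc : IsSimplyConnected D) (hp : p ∈ D) (hL : BergmanLowerCondition D p) :
    ∃ S : ℂ → ℂ, IsBiholomorphicWithInv (bergmanCoord D p) S D (bergmanDisc D p) ∧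
      ContinuousOn S (closure (bergmanDisc D p)) := by
  obtain ⟨C, hC, hK⟩ := hL
  obtain ⟨f, hf, hfp, him⟩ := exists_isDiscEmbedding_image_eq_ball hD hb hsc hp
  have hB := isBiholomorphicWithInv_bergmanCoord hD hf him hp hfp
  have hdisc := bergmanDisc_eq_ball hD hf him hp hfp
  set S₀ : ℂ → ℂ := fun w => Function.invFunOn f D (deriv f p * w) with hS₀
  have h0 := hf.deriv_ne p hp
  have h0' : 0 < ‖deriv f p‖ := norm_pos_iff.2 h0
  have hopen : IsOpen (bergmanDisc D p) := by rw [hdisc]; exact Metric.isOpen_ball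
  -- S₀'(w) = f'(p) / f'(S₀ w), and the lower bound on the kernel reads |f'| ≥ Cπ / |f'(p)|.
  have hder : ∀ w ∈ bergmanDisc D p, ‖deriv S₀ w‖₊ ≤
      Real.toNNReal (‖deriv f p‖ ^ 2 / (C * Real.pi)) := by
    intro w hw
    have hz : S₀ w ∈ D := hB.2.2.2.1 hw
    have hfz : f (S₀ w) = deriv f p * w := by
      have := hB.2.2.2.2.2 hw
      rw [bergmanCoord_eq_of_isDiscEmbedding hD hf him hp hfp hz, div_eq_iff h0] at this
      rw [this, mul_comm]
    have h1 := hasDerivAt_invFunOn hD hf.diff hf.inj hz (hf.deriv_ne _ hz)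
    rw [hfz] at h1
    have h2 : HasDerivAt (fun w => deriv f p * w) (deriv f p) w := by
      simpa using (hasDerivAt_id w).const_mul (deriv f p)
    have h3 : HasDerivAt S₀ ((deriv f (S₀ w))⁻¹ * deriv f p) w := h1.comp w h2
    rw [h3.deriv]
    refine NNReal.le_toNNReal_of_coe_le ?_
    rw [coe_nnnorm, norm_mul, norm_inv]
    have h4 := hK _ hz
    rw [norm_bergmanKernel_eq_of_isDiscEmbedding hD hf him hp hfp hz,
      le_div_iff₀ Real.pi_pos] at h4
    have h5 : 0 < ‖deriv f (S₀ w)‖ := norm_pos_iff.2 (hf.deriv_ne _ hz)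
    have := Real.pi_pos
    rw [inv_mul_eq_div, div_le_div_iff₀ h5 (by positivity)]
    nlinarith
  have hlip : LipschitzOnWith _ S₀ (bergmanDisc D p) :=
    Convex.lipschitzOnWith_of_nnnorm_deriv_le
      (fun w hw => hB.2.1.differentiableAt (hopen.mem_nhds hw)) hder
      (by rw [hdisc]; exact convex_ball _ _)
  -- The Lipschitz extension to all of ℂ agrees with `S₀` on the open disc, which suffices to keep
  -- the inverse relations.
  obtain ⟨S, hS, hSe⟩ := hlip.extend_finite_dimension
  refine ⟨S, ⟨hB.1, hB.2.1.congr hSe.symm, hB.2.2.1, hB.2.2.2.1.congr hSe, ?_, ?_⟩,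
    hS.continuous.continuousOn⟩
  · intro z hz
    rw [← hSe (hB.2.2.1 hz)]
    exact hB.2.2.2.2.1 hz
  · intro w hw
    rw [← hSe hw]
    exact hB.2.2.2.2.2 hw

end

/-- Two continuous extensions to the closures of mutually inverse maps form a homeomorphism of the
closures. -/
theorem exists_homeomorph_closure {X Y : Type*} [TopologicalSpace X] [TopologicalSpace Y]
    [T2Space X] [T2Space Y] {A : Set X} {B : Set Y} {T : X → Y} {S : Y → X}
    (hT : ContinuousOn T (closure A)) (hS : ContinuousOn S (closure B)) (hTm : MapsTo T A B)
    (hSm : MapsTo S B A) (hinv : InvOn S T A B) :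
    InvOn S T (closure A) (closure B) ∧ ∃ Φ : closure A ≃ₜ closure B, ∀ z, (Φ z : Y) = T z := by
  have hTc := hTm.closure_of_continuousOn hT
  have hSc := hSm.closure_of_continuousOn hS
  have h1 : LeftInvOn S T (closure A) :=
    EqOn.of_subset_closure (f := S ∘ T) (g := id) hinv.1 (hS.comp hT hTc) continuousOn_id
      subset_closure le_rfl
  have h2 : LeftInvOn T S (closure B) :=
    EqOn.of_subset_closure (f := T ∘ S) (g := id) hinv.2 (hT.comp hS hSc) continuousOn_id
      subset_closure le_rfl
  refine ⟨⟨h1, h2⟩, ⟨⟨hTc.restrict, hSc.restrict, ?_, ?_⟩, ?_, ?_⟩, fun z => rfl⟩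
  · exact fun z => Subtype.ext (h1 z.2)
  · exact fun z => Subtype.ext (h2 z.2)
  · exact hT.mapsToRestrict hTc
  · exact hS.mapsToRestrict hSc

theorem mainTheorem6 (D : Set ℂ) (hopen : IsOpen D) (hbdd : Bornology.IsBounded D)
    (hsc : IsSimplyConnected D) (p : ℂ) (hp : p ∈ D) :
    (0 < bergmanMetric D p ∧ (∀ z ∈ D, bergmanKernel D z p ≠ 0) ∧
      IsBiholomorphicOnto (bergmanCoord D p) D (bergmanDisc D p)) ∧
    (BergmanUpperCondition D →
      ∃ T' : ℂ → ℂ, ContinuousOn T' (closure D) ∧ EqOn T' (bergmanCoord D p) D) ∧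
    (BergmanLowerCondition D p →
      (∃ S : ℂ → ℂ, IsBiholomorphicWithInv (bergmanCoord D p) S D (bergmanDisc D p) ∧
        ContinuousOn S (closure (bergmanDisc D p))) ∧
      LocallyConnectedSpace (frontier D)) ∧
    (BergmanUpperCondition D → BergmanLowerCondition D p →
      (∃ Φ : closure D ≃ₜ closure (bergmanDisc D p),
        ∀ z (hz : z ∈ D), (Φ ⟨z, subset_closure hz⟩ : ℂ) = bergmanCoord D p z) ∧
      IsJordanCurve (frontier D)) := by
  obtain ⟨f, hf, hfp, him⟩ := exists_isDiscEmbedding_image_eq_ball hopen hbdd hsc hp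
  have h0 : 0 < ‖deriv f p‖ := norm_pos_iff.2 (hf.deriv_ne p hp)
  set r := ‖deriv f p‖⁻¹ with hr
  have hr0 : 0 < r := inv_pos.2 h0
  have hdisc : bergmanDisc D p = Metric.ball 0 r := bergmanDisc_eq_ball hopen hf him hp hfp
  have hcl : closure (bergmanDisc D p) = Metric.closedBall 0 r := by
    rw [hdisc, closure_ball _ hr0.ne']
  have hfront : ∀ S : ℂ → ℂ, IsBiholomorphicWithInv (bergmanCoord D p) S D (bergmanDisc D p) →
      ContinuousOn S (closure (bergmanDisc D p)) → S '' Metric.sphere 0 r = frontier D := by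
    intro S hS hSc
    rw [hcl] at hSc
    rw [hdisc] at hS
    exact image_sphere_eq_frontier hopen hr0 hS.1.continuousOn hS.2.2.1 hS.2.2.2.1 hS.2.2.2.2 hSc
  refine ⟨⟨?_, ?_, _, isBiholomorphicWithInv_bergmanCoord hopen hf him hp hfp⟩,
    exists_extension_bergmanCoord hopen hbdd hsc hp, fun hL => ?_, fun hU hL => ?_⟩
  · rw [bergmanMetric_eq_of_isDiscEmbedding hopen hf him hp hfp]
    positivity
  · intro z hz
    have h1 : 0 < ‖deriv f z‖ := norm_pos_iff.2 (hf.deriv_ne z hz)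
    rw [← norm_pos_iff, norm_bergmanKernel_eq_of_isDiscEmbedding hopen hf him hp hfp hz]
    have := Real.pi_pos
    positivity
  · obtain ⟨S, hS, hSc⟩ := exists_extension_bergmanCoord_inv hopen hbdd hsc hp hL
    refine ⟨⟨S, hS, hSc⟩, ?_⟩
    rw [← hfront S hS hSc]
    refine locallyConnectedSpace_image_sphere hr0 (hSc.mono ?_)
    rw [hcl]
    exact Metric.sphere_subset_closedBall
  · obtain ⟨S, hS, hSc⟩ := exists_extension_bergmanCoord_inv hopen hbdd hsc hp hL
    obtain ⟨T', hT', hTe⟩ := exists_extension_bergmanCoord hopen hbdd hsc hp hU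
    obtain ⟨hinv, Φ, hΦ⟩ := exists_homeomorph_closure hT' hSc (hS.2.2.1.congr hTe.symm)
      hS.2.2.2.1 ⟨fun z hz => by rw [hTe hz]; exact hS.2.2.2.2.1 hz,
        fun w hw => by rw [hTe (hS.2.2.2.1 hw)]; exact hS.2.2.2.2.2 hw⟩
    refine ⟨⟨Φ, fun z hz => by rw [hΦ]; exact hTe hz⟩, fun c => S (r * c), ?_, ?_, ?_⟩
    · refine hSc.comp_continuous (by fun_prop) fun c => ?_
      rw [hcl]
      exact Metric.sphere_subset_closedBall (range_mul_circle hr0 ▸ mem_range_self c)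
    · intro c d hcd
      have hm : ∀ c : Circle, (r : ℂ) * c ∈ closure (bergmanDisc D p) := fun c => by
        rw [hcl]
        exact Metric.sphere_subset_closedBall (range_mul_circle hr0 ▸ mem_range_self c)
      -- `T'` is a left inverse of `S` on the closed disc, so the boundary parametrization is
      -- injective.
      have h1 := hinv.2.injOn (hm c) (hm d) hcd
      have hrC : (r : ℂ) ≠ 0 := by exact_mod_cast hr0.ne'
      exact Circle.coe_injective (mul_left_cancel₀ hrC h1)
    · rw [← hfront S hS hSc, ← range_mul_circle hr0, ← range_comp]
      rfl
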